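/- **Setting.** An algebraic weak factorization system (AWFS) $(\mathbb L,\mathbb R)$ on a category $\mathcal M$ is a functorial factorization $f = Rf\circ Lf$, $X\xrightarrow{Lf}Ef\xrightarrow{Rf}Y$, together with fillers $\delta_f\colon Ef\to E(Lf)$ and $\mu_f\colon E(Rf)\to Ef$ making $L$ (with counit $(1,Rf)\colon Lf\to f$) a comonad $\mathbb L$ and $R$ (with unit $(Lf,1)\colon f\to Rf$) a monad $\mathbb R$ on the arrow category $\mathcal M^{\mathbf 2}$, such that $(\delta,\mu)\colon LR\Rightarrow RL$ is a distributive law. An *$\mathbb L$-map* (*$\mathbb R$-map*) is a coalgebra for $\mathbb L$ (algebra for $\mathbb R$), and $\exists\mathbb L$ is the class of maps that admit an $\mathbb L$-map structure. The *underlying weak factorization system* $(\mathcal L,\mathcal R)$ has as left class the maps admitting a coalgebra structure for the copointed endofunctor $L$ and as right class the maps admitting an algebra structure for the pointed endofunctor $R$. $\mathrm{Retr}$ denotes closure under retracts. The $\mathbb L$-maps are the vertical arrows, and the maps of coalgebras the squares, of a double category over the double category $\mathrm{Sq}(\mathcal M)$ of commutative squares; likewise for $\mathbb R$-maps. An AWFS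 $(\mathbb L',\mathbb R')$ on $\mathcal K$ is the *left-lifting* of $(\mathbb L,\mathbb R)$ along a left adjoint $V\colon\mathcal K\to\mathcal M$ if its double category of $\mathbb L'$-maps is the pullback along $\mathrm{Sq}(V)$ of that of $\mathbb L$-maps; *right-liftings* along a right adjoint $U$ are defined in the same way with $\mathbb R$-maps. The left-lifting of a weak factorization system $(\mathcal L,\mathcal R)$ along $V$ is the pair $(V^{-1}\mathcal L,(V^{-1}\mathcal L)^{\pitchfork})$ of $V^{-1}\mathcal L$ and the maps with the right lifting property against it; its right-lifting along $U$ is the pair $({}^{\pitchfork}(U^{-1}\mathcal R),U^{-1}\mathcal R)$ of the maps with the left lifting property against $U^{-1}\mathcal R$, and $U^{-1}\mathcal R$. **Claim.** (i) Whenever the left-lifting of an AWFS along a left adjoint exists, its underlying weak factorization system is the left-lifting of the underlying weak factorization system. (ii) Whenever the right-lifting of an AWFS along a right adjoint exists, its underlying weak factorization system is the right-lifting of the underlying weak factorization system. **Proposition.** Both parts of the Claim are false. More precisely: 1. For every AWFS $(\mathbb L,\mathbb R)$ on $\mathcal M$ with a left-lifting along a left adjoint $V\colon\mathcal K\to\mathcal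 M$ one has $\mathrm{Retr}(V^{-1}(\exists\mathbb L))\subseteq V^{-1}(\mathrm{Retr}(\exists\mathbb L))$, and the underlying weak factorization system of the left-lifting is the left-lifting of the underlying weak factorization system if and only if $$\mathrm{Retr}(V^{-1}(\exists\mathbb L)) = V^{-1}(\mathrm{Retr}(\exists\mathbb L)).\qquad(*)$$ 2. Part (i) fails and part (ii) fails (for locally small large categories). 3. For a comonad $(P,\upsilon,\Delta)$ on a category with binary coproducts consider the AWFS that factors $f\colon X\to Y$ as $X\xrightarrow{\iota_1}X+PY\xrightarrow{\langle f,\upsilon_Y\rangle}Y$, with $\delta_f = 1_X+P\iota_2\circ\Delta_Y\colon X+PY\to X+P(X+PY)$ and $\mu_f = 1_X+\nabla_{PY}\colon X+PY+PY\to X+PY$. * Let $P$ be the comonad on $\mathrm{Mod}_{\mathbb Z/6}$ generated by the free–forgetful adjunction with sets, and $V=\mathbb Z/2\otimes_{\mathbb Z/6}(-)\colon\mathrm{Mod}_{\mathbb Z/6}\to\mathrm{Mod}_{\mathbb Z/6}$. Then $V$ is a left adjoint, the AWFS of $P$ has a left-lifting along $V$, and no such left-lifting satisfies the conclusion of (i).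 The inclusion in 1 is strict: $0\to\mathbb Z/6$ lies in $V^{-1}(\mathrm{Retr}(\exists\mathbb L))$ but not in $\mathrm{Retr}(V^{-1}(\exists\mathbb L))$. * Let $M=\{1,e\}$ be the monoid with $e^2=e$, let $P$ be the comonad on $M\text{-}\mathrm{Set}$ generated by the free–forgetful adjunction with sets, and let $V\colon\mathrm{Set}\to M\text{-}\mathrm{Set}$ endow each set with the trivial $M$-action. Then $V$ is a left adjoint, the AWFS of $P$ has a left-lifting along $V$, and no such left-lifting satisfies the conclusion of (i). The inclusion in 1 is strict: for every set $X$ the map $\varnothing\to X$ lies in $V^{-1}(\mathrm{Retr}(\exists\mathbb L))$, and it lies in $\mathrm{Retr}(V^{-1}(\exists\mathbb L))$ if and only if $X=\varnothing$. -/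

import Mathlib

open CategoryTheory Limits

universe w v u v' u'

namespace AWFSLifting

/-! ### Algebraic weak factorization systems -/

/-- A functorial factorization `f = lam f ≫ rho f` through `E f`, on the category `C`. -/
structure FunctorialFactorization (C : Type u) [Category.{v} C] where
  /-- the middle object -/
  E : Arrow C ⥤ C
  /-- the left factor -/
  lam (f : Arrow C) : f.left ⟶ E.obj f
  /-- the right factor -/
  rho (f : Arrow C) : E.obj f ⟶ f.right
  fac (f : Arrow C) : lam f ≫ rho f = f.hom
  lam_naturality {f g : Arrow C} (φ : f ⟶ g) : lam f ≫ E.map φ = φ.left ≫ lam g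
  rho_naturality {f g : Arrow C} (φ : f ⟶ g) : E.map φ ≫ rho g = rho f ≫ φ.right

namespace FunctorialFactorization

variable {C : Type u} [Category.{v} C] (F : FunctorialFactorization C)

/-- The endofunctor `L` of the arrow category, sending `f` to its left factor. -/
def L : Arrow C ⥤ Arrow C where
  obj f := Arrow.mk (F.lam f)
  map {f g} φ := Arrow.homMk φ.left (F.E.map φ) (F.lam_naturality φ).symm

/-- The endofunctor `R` of the arrow category, sending `f` to its right factor. -/
def R : Arrow C ⥤ Arrow C where
  obj f := Arrow.mk (F.rho f)
  map {f g} φ := Arrow.homMk (F.E.map φ) φ.right (F.rho_naturality φ)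

/-- The counit `L ⟶ 1`, with component `(1, rho f) : L f ⟶ f`. -/
def eps : F.L ⟶ 𝟭 (Arrow C) where
  app f := Arrow.homMk (𝟙 f.left) (F.rho f) ((Category.id_comp _).trans (F.fac f).symm)
  naturality f g φ := by
    ext
    · exact (Category.comp_id _).trans (Category.id_comp _).symm
    · exact F.rho_naturality φ

/-- The unit `1 ⟶ R`, with component `(lam f, 1) : f ⟶ R f`. -/
def eta : 𝟭 (Arrow C) ⟶ F.R where
  app f := Arrow.homMk (F.lam f) (𝟙 f.right) ((F.fac f).trans (Category.comp_id _).symm)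
  naturality f g φ := by
    ext
    · exact (F.lam_naturality φ).symm
    · exact (Category.comp_id _).trans (Category.id_comp _).symm

end FunctorialFactorization

/-- An algebraic weak factorization system: a functorial factorization `(L, R)` with fillers
`del f : E f ⟶ E (L f)` and `mu f : E (R f) ⟶ E f` which make `L` a comonad, `R` a monad, and such
that `(del, mu) : L R ⟶ R L` is a distributive law (see `AWFS.comonad`, `AWFS.monad`,
`AWFS.isDistributiveLaw` below). -/
structure AWFS (C : Type u) [Category.{v} C] extends FunctorialFactorization C where
  /-- the comultiplication filler -/
  del (f : Arrow C) : E.obj f ⟶ E.obj (toFunctorialFactorization.L.obj f)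
  /-- the multiplication filler -/
  mu (f : Arrow C) : E.obj (toFunctorialFactorization.R.obj f) ⟶ E.obj f
  del_naturality {f g : Arrow C} (φ : f ⟶ g) :
    E.map φ ≫ del g = del f ≫ E.map (toFunctorialFactorization.L.map φ)
  mu_naturality {f g : Arrow C} (φ : f ⟶ g) :
    E.map (toFunctorialFactorization.R.map φ) ≫ mu g = mu f ≫ E.map φ
  lam_del (f : Arrow C) : lam f ≫ del f = lam (toFunctorialFactorization.L.obj f)
  del_rho (f : Arrow C) : del f ≫ rho (toFunctorialFactorization.L.obj f) = 𝟙 _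
  lam_mu (f : Arrow C) : lam (toFunctorialFactorization.R.obj f) ≫ mu f = 𝟙 _
  mu_rho (f : Arrow C) : mu f ≫ rho f = rho (toFunctorialFactorization.R.obj f)
  del_eps (f : Arrow C) : del f ≫ E.map (toFunctorialFactorization.eps.app f) = 𝟙 _
  eta_mu (f : Arrow C) : E.map (toFunctorialFactorization.eta.app f) ≫ mu f = 𝟙 _
  coassoc (f : Arrow C) :
    del f ≫ del (toFunctorialFactorization.L.obj f) =
      del f ≫ E.map (Arrow.homMk (f := toFunctorialFactorization.L.obj f)
        (g := toFunctorialFactorization.L.obj (toFunctorialFactorization.L.obj f))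
        (𝟙 f.left) (del f) ((Category.id_comp _).trans (lam_del f).symm))
  assoc (f : Arrow C) :
    mu (toFunctorialFactorization.R.obj f) ≫ mu f =
      E.map (Arrow.homMk
        (f := toFunctorialFactorization.R.obj (toFunctorialFactorization.R.obj f))
        (g := toFunctorialFactorization.R.obj f)
        (mu f) (𝟙 f.right) ((mu_rho f).trans (Category.comp_id _).symm)) ≫ mu f
  distrib (f : Arrow C) :
    mu f ≫ del f =
      del (toFunctorialFactorization.R.obj f) ≫
        E.map (Arrow.homMk
          (f := toFunctorialFactorization.L.obj (toFunctorialFactorization.R.obj f))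
          (g := toFunctorialFactorization.R.obj (toFunctorialFactorization.L.obj f))
          (del f) (mu f) ((del_rho f).trans (lam_mu f).symm)) ≫
        mu (toFunctorialFactorization.L.obj f)

namespace AWFS

variable {C : Type u} [Category.{v} C] (A : AWFS C)

/-- The component `(1, del f) : L f ⟶ L L f` of the comultiplication. -/
def delVec (f : Arrow C) : A.L.obj f ⟶ A.L.obj (A.L.obj f) :=
  Arrow.homMk (𝟙 f.left) (A.del f) ((Category.id_comp _).trans (A.lam_del f).symm)

/-- The component `(mu f, 1) : R R f ⟶ R f` of the multiplication. -/
def muVec (f : Arrow C) : A.R.obj (A.R.obj f) ⟶ A.R.obj f :=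
  Arrow.homMk (A.mu f) (𝟙 f.right) ((A.mu_rho f).trans (Category.comp_id _).symm)

/-- The component `(del f, mu f) : L R f ⟶ R L f` of the distributive law. -/
def distVec (f : Arrow C) : A.L.obj (A.R.obj f) ⟶ A.R.obj (A.L.obj f) :=
  Arrow.homMk (A.del f) (A.mu f) ((A.del_rho f).trans (A.lam_mu f).symm)

/-- The comonad `𝕃` on the arrow category. -/
def comonad : Comonad (Arrow C) where
  toFunctor := A.L
  ε := A.eps
  δ :=
    { app := A.delVec
      naturality := fun f g φ => by
        ext
        · exact (Category.comp_id _).trans (Category.id_comp _).symm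
        · exact A.del_naturality φ }
  coassoc f := by
    ext
    · rfl
    · exact (A.coassoc f).symm
  left_counit f := by
    ext
    · exact Category.id_comp _
    · exact A.del_rho f
  right_counit f := by
    ext
    · exact Category.id_comp _
    · exact A.del_eps f

/-- The monad `ℝ` on the arrow category. -/
def monad : Monad (Arrow C) where
  toFunctor := A.R
  η := A.eta
  μ :=
    { app := A.muVec
      naturality := fun f g φ => by
        ext
        · exact A.mu_naturality φ
        · exact (Category.comp_id _).trans (Category.id_comp _).symm }
  assoc f := by
    ext
    · exact (A.assoc f).symm
    · rfl
  left_unit f := by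
    ext
    · exact A.lam_mu f
    · exact Category.id_comp _
  right_unit f := by
    ext
    · exact A.eta_mu f
    · exact Category.id_comp _

end AWFS

/-- A family of maps `l X : G (T X) ⟶ T (G X)` is a distributive law of the comonad `G` over the
monad `T`: it is natural and compatible with unit, counit, multiplication and comultiplication. -/
structure IsDistributiveLaw {D : Type u} [Category.{v} D] (G : Comonad D) (T : Monad D)
    (l : ∀ X : D, G.obj (T.obj X) ⟶ T.obj (G.obj X)) : Prop where
  naturality {X Y : D} (φ : X ⟶ Y) : G.map (T.map φ) ≫ l Y = l X ≫ T.map (G.map φ)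
  unit (X : D) : G.map (T.η.app X) ≫ l X = T.η.app (G.obj X)
  counit (X : D) : l X ≫ T.map (G.ε.app X) = G.ε.app (T.obj X)
  mul (X : D) : G.map (T.μ.app X) ≫ l X = l (T.obj X) ≫ T.map (l X) ≫ T.μ.app (G.obj X)
  comul (X : D) : l X ≫ T.map (G.δ.app X) = G.δ.app (T.obj X) ≫ G.map (l X) ≫ l (G.obj X)

namespace AWFS

variable {C : Type u} [Category.{v} C] (A : AWFS C)

theorem isDistributiveLaw : IsDistributiveLaw A.comonad A.monad A.distVec where
  naturality {f g} φ := by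
    ext
    · exact A.del_naturality φ
    · exact A.mu_naturality φ
  unit f := by
    ext
    · exact A.lam_del f
    · exact A.eta_mu f
  counit f := by
    ext
    · exact A.del_eps f
    · exact A.mu_rho f
  mul f := by
    ext
    · exact A.distrib f
    · exact (A.assoc f).symm.trans (congrArg (A.mu _ ≫ ·) (Category.comp_id _).symm)
  comul f := by
    ext
    · exact (A.coassoc f).symm.trans (Category.id_comp _).symm
    · exact A.distrib f

/-! ### `𝕃`-maps and `ℝ`-maps -/

/-- An `𝕃`-map structure on `f : X ⟶ Y`: a coalgebra structure `(1, s) : f ⟶ L f` for the comonad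
`𝕃`. -/
@[ext]
structure LMap {X Y : C} (f : X ⟶ Y) where
  /-- the filler -/
  s : Y ⟶ A.E.obj (Arrow.mk f)
  comp_s : f ≫ s = A.lam (Arrow.mk f)
  s_rho : s ≫ A.rho (Arrow.mk f) = 𝟙 Y
  s_del : s ≫ A.del (Arrow.mk f) =
    s ≫ A.E.map (Arrow.homMk (f := Arrow.mk f) (g := A.L.obj (Arrow.mk f)) (𝟙 X) s
      ((Category.id_comp _).trans comp_s.symm))

/-- An `ℝ`-map structure on `f : X ⟶ Y`: an algebra structure `(p, 1) : R f ⟶ f` for the monad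
`ℝ`. -/
@[ext]
structure RMap {X Y : C} (f : X ⟶ Y) where
  /-- the filler -/
  p : A.E.obj (Arrow.mk f) ⟶ X
  lam_p : A.lam (Arrow.mk f) ≫ p = 𝟙 X
  p_comp : p ≫ f = A.rho (Arrow.mk f)
  mu_p : A.mu (Arrow.mk f) ≫ p =
    A.E.map (Arrow.homMk (f := A.R.obj (Arrow.mk f)) (g := Arrow.mk f) p (𝟙 Y)
      (p_comp.trans (Category.comp_id _).symm)) ≫ p

theorem nonempty_lMap_iff {X Y : C} (f : X ⟶ Y) :
    Nonempty (A.LMap f) ↔ ∃ a : A.comonad.Coalgebra, a.A = Arrow.mk f := by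
  constructor
  · rintro ⟨s⟩
    refine ⟨⟨Arrow.mk f, Arrow.homMk (f := Arrow.mk f) (g := A.L.obj (Arrow.mk f)) (𝟙 X) s.s
      ((Category.id_comp _).trans s.comp_s.symm), ?_, ?_⟩, rfl⟩
    · ext
      · exact Category.id_comp _
      · exact s.s_rho
    · ext
      · rfl
      · exact s.s_del
  · rintro ⟨⟨B, a, h₁, h₂⟩, rfl⟩
    have e₁ : a.left = 𝟙 X := by
      have := congrArg (fun φ => Arrow.Hom.left φ) h₁
      exact (Category.comp_id _).symm.trans this
    have e₂ : a = Arrow.homMk (f := Arrow.mk f) (g := A.L.obj (Arrow.mk f)) (𝟙 X) a.right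
        ((congrArg (· ≫ A.lam (Arrow.mk f)) e₁.symm).trans a.w) := by
      ext
      · exact e₁
      · rfl
    refine ⟨⟨a.right, ?_, ?_, ?_⟩⟩
    · have := a.w
      exact this.symm.trans ((congrArg (· ≫ A.lam (Arrow.mk f)) e₁).trans (Category.id_comp _))
    · exact congrArg (fun φ => Arrow.Hom.right φ) h₁
    · have := congrArg (fun φ => Arrow.Hom.right φ) h₂
      exact this.trans (congrArg (fun φ => a.right ≫ A.E.map φ) e₂)

theorem nonempty_rMap_iff {X Y : C} (f : X ⟶ Y) :
    Nonempty (A.RMap f) ↔ ∃ a : A.monad.Algebra, a.A = Arrow.mk f := by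
  constructor
  · rintro ⟨p⟩
    refine ⟨⟨Arrow.mk f, Arrow.homMk (f := A.R.obj (Arrow.mk f)) (g := Arrow.mk f) p.p (𝟙 Y)
      (p.p_comp.trans (Category.comp_id _).symm), ?_, ?_⟩, rfl⟩
    · ext
      · exact p.lam_p
      · exact Category.id_comp _
    · ext
      · exact p.mu_p
      · rfl
  · rintro ⟨⟨B, a, h₁, h₂⟩, rfl⟩
    have e₁ : a.right = 𝟙 Y := by
      have := congrArg (fun φ => Arrow.Hom.right φ) h₁
      exact (Category.id_comp _).symm.trans this
    have e₂ : a = Arrow.homMk (f := A.R.obj (Arrow.mk f)) (g := Arrow.mk f) a.left (𝟙 Y)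
        (a.w.trans (congrArg (A.rho (Arrow.mk f) ≫ ·) e₁)) := by
      ext
      · rfl
      · exact e₁
    refine ⟨⟨a.left, ?_, ?_, ?_⟩⟩
    · exact congrArg (fun φ => Arrow.Hom.left φ) h₁
    · have := a.w
      exact this.trans ((congrArg (A.rho (Arrow.mk f) ≫ ·) e₁).trans (Category.comp_id _))
    · have := congrArg (fun φ => Arrow.Hom.left φ) h₂
      exact this.trans (congrArg (fun φ => A.E.map φ ≫ a.left) e₂)

/-- The identity `𝕃`-map. -/
def LMap.id (X : C) : A.LMap (𝟙 X) where
  s := A.lam (Arrow.mk (𝟙 X))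
  comp_s := Category.id_comp _
  s_rho := A.fac _
  s_del := (A.lam_del _).trans ((Category.id_comp _).symm.trans
    (A.lam_naturality (Arrow.homMk (f := Arrow.mk (𝟙 X)) (g := A.L.obj (Arrow.mk (𝟙 X))) (𝟙 X)
      (A.lam (Arrow.mk (𝟙 X))) rfl)).symm)

/-- The identity `ℝ`-map. -/
def RMap.id (X : C) : A.RMap (𝟙 X) where
  p := A.rho (Arrow.mk (𝟙 X))
  lam_p := A.fac _
  p_comp := Category.comp_id _
  mu_p := (A.mu_rho _).trans ((Category.comp_id _).symm.trans
    (A.rho_naturality (Arrow.homMk (f := A.R.obj (Arrow.mk (𝟙 X))) (g := Arrow.mk (𝟙 X))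
      (A.rho (Arrow.mk (𝟙 X))) (𝟙 X) rfl)).symm)

variable {A}

theorem E_comp {f g h : Arrow C} (φ : f ⟶ g) (ψ : g ⟶ h) (χ : f ⟶ h)
    (hl : φ.left ≫ ψ.left = χ.left) (hr : φ.right ≫ ψ.right = χ.right) :
    A.E.map φ ≫ A.E.map ψ = A.E.map χ := by
  rw [← A.E.map_comp]
  congr 1
  ext
  · exact hl
  · exact hr

section LComp

variable {X Y Z : C} {f : X ⟶ Y} {g : Y ⟶ Z} (s : A.LMap f) (t : A.LMap g)

/-- The filler `Y ⟶ E (f ≫ g)` of the square from `f` to `rho (f ≫ g)` with sides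
`lam (f ≫ g)` and `g`, determined by the `𝕃`-map structure of `f`. -/
def LMap.mid : Y ⟶ A.E.obj (Arrow.mk (f ≫ g)) :=
  s.s ≫ A.E.map (Arrow.homMk (f := Arrow.mk f) (g := Arrow.mk (f ≫ g)) (𝟙 X) g
    (Category.id_comp _))

theorem LMap.comp_mid : f ≫ s.mid (g := g) = A.lam (Arrow.mk (f ≫ g)) := by
  unfold LMap.mid
  rw [← Category.assoc, s.comp_s, A.lam_naturality]
  exact Category.id_comp _

theorem LMap.mid_rho : s.mid (g := g) ≫ A.rho (Arrow.mk (f ≫ g)) = g := by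
  unfold LMap.mid
  rw [Category.assoc, A.rho_naturality, ← Category.assoc, s.s_rho]
  exact Category.id_comp _

/-- The filler `Z ⟶ E (f ≫ g)` of the square from `g` to `rho (f ≫ g)` with sides `mid` and `𝟙`,
determined by the `𝕃`-map structure of `g` and the `ℝ`-map `rho (f ≫ g)`. -/
def LMap.compS : Z ⟶ A.E.obj (Arrow.mk (f ≫ g)) :=
  t.s ≫ A.E.map (Arrow.homMk (f := Arrow.mk g) (g := A.R.obj (Arrow.mk (f ≫ g))) s.mid (𝟙 Z)
    (s.mid_rho.trans (Category.comp_id _).symm)) ≫ A.mu (Arrow.mk (f ≫ g))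

theorem LMap.comp_compS : g ≫ s.compS t = s.mid := by
  unfold LMap.compS
  rw [← Category.assoc, t.comp_s, ← Category.assoc, A.lam_naturality, Category.assoc, A.lam_mu]
  exact Category.comp_id _

theorem LMap.compS_rho : s.compS t ≫ A.rho (Arrow.mk (f ≫ g)) = 𝟙 Z := by
  unfold LMap.compS
  rw [Category.assoc, Category.assoc, A.mu_rho]
  refine (congrArg (t.s ≫ ·) (A.rho_naturality _)).trans ?_
  exact (Category.assoc _ _ _).symm.trans
    ((congrArg (· ≫ 𝟙 Z) t.s_rho).trans (Category.id_comp _))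

theorem LMap.comp_comp_compS : (f ≫ g) ≫ s.compS t = A.lam (Arrow.mk (f ≫ g)) := by
  rw [Category.assoc, s.comp_compS, s.comp_mid]

theorem LMap.mid_del : s.mid ≫ A.del (Arrow.mk (f ≫ g)) =
    s.mid ≫ A.E.map (Arrow.homMk (f := Arrow.mk (f ≫ g)) (g := A.L.obj (Arrow.mk (f ≫ g)))
      (𝟙 X) (s.compS t) ((Category.id_comp _).trans (s.comp_comp_compS t).symm)) := by
  have w : 𝟙 X ≫ A.lam (Arrow.mk (f ≫ g)) = f ≫ s.mid (g := g) :=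
    (Category.id_comp _).trans s.comp_mid.symm
  trans s.s ≫ A.E.map (Arrow.homMk (f := Arrow.mk f) (g := A.L.obj (Arrow.mk (f ≫ g)))
    (𝟙 X) s.mid w)
  · conv_lhs => unfold LMap.mid
    rw [Category.assoc, A.del_naturality, ← Category.assoc, s.s_del, Category.assoc]
    congr 1
    exact E_comp _ _ _ (Category.id_comp _) rfl
  · conv_rhs => unfold LMap.mid
    rw [Category.assoc]
    congr 1
    exact (E_comp _ _ _ (Category.id_comp _) (s.comp_compS t)).symm

/-- Vertical composition of `𝕃`-maps. -/
def LMap.comp : A.LMap (f ≫ g) where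
  s := s.compS t
  comp_s := s.comp_comp_compS t
  s_rho := s.compS_rho t
  s_del := by
    have w₁ : s.mid ≫ A.del (Arrow.mk (f ≫ g)) ≫ A.rho (A.L.obj (Arrow.mk (f ≫ g))) =
        g ≫ s.compS t := by
      rw [A.del_rho, s.comp_compS]
      exact Category.comp_id _
    trans t.s ≫ A.E.map (Arrow.homMk (f := Arrow.mk g)
      (g := A.R.obj (A.L.obj (Arrow.mk (f ≫ g)))) (s.mid ≫ A.del (Arrow.mk (f ≫ g)))
      (s.compS t) ((Category.assoc _ _ _).trans w₁)) ≫ A.mu (A.L.obj (Arrow.mk (f ≫ g)))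
    · conv_lhs => unfold LMap.compS
      rw [Category.assoc, Category.assoc, A.distrib, ← Category.assoc (A.E.map _),
        A.del_naturality, Category.assoc, ← Category.assoc, t.s_del, Category.assoc]
      congr 1
      rw [← Category.assoc, ← Category.assoc]
      congr 1
      rw [Category.assoc]
      refine (congrArg (_ ≫ ·) (E_comp _ _ (Arrow.homMk (f := A.L.obj (Arrow.mk g))
        (g := A.R.obj (A.L.obj (Arrow.mk (f ≫ g)))) (s.mid ≫ A.del (Arrow.mk (f ≫ g)))
        (A.E.map (Arrow.homMk (f := Arrow.mk g) (g := A.R.obj (Arrow.mk (f ≫ g))) s.mid (𝟙 Z)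
          (s.mid_rho.trans (Category.comp_id _).symm)) ≫ A.mu (Arrow.mk (f ≫ g))) ?_)
        rfl rfl)).trans ?_
      · refine (Category.assoc _ _ _).trans (w₁.trans ?_)
        exact (Category.assoc _ _ _).symm.trans (congrArg (· ≫ _) t.comp_s)
      · exact E_comp _ _ _ (Category.id_comp _) rfl
    · conv_rhs => unfold LMap.compS
      rw [Category.assoc, Category.assoc, ← A.mu_naturality, ← Category.assoc (A.E.map _)]
      congr 2
      exact (E_comp _ _ _ (s.mid_del t).symm (Category.id_comp _)).symm

end LComp

section RComp

variable {X Y Z : C} {f : X ⟶ Y} {g : Y ⟶ Z} (p : A.RMap f) (q : A.RMap g)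

/-- The filler `E (f ≫ g) ⟶ Y` of the square from `lam (f ≫ g)` to `g` with sides `f` and
`rho (f ≫ g)`, determined by the `ℝ`-map structure of `g`. -/
def RMap.mid : A.E.obj (Arrow.mk (f ≫ g)) ⟶ Y :=
  A.E.map (Arrow.homMk (f := Arrow.mk (f ≫ g)) (g := Arrow.mk g) f (𝟙 Z)
    (Category.comp_id _).symm) ≫ q.p

theorem RMap.mid_comp : q.mid (f := f) ≫ g = A.rho (Arrow.mk (f ≫ g)) := by
  unfold RMap.mid
  rw [Category.assoc, q.p_comp, A.rho_naturality]
  exact Category.comp_id _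

theorem RMap.lam_mid : A.lam (Arrow.mk (f ≫ g)) ≫ q.mid = f := by
  unfold RMap.mid
  rw [← Category.assoc, A.lam_naturality, Category.assoc, q.lam_p]
  exact Category.comp_id _

/-- The filler `E (f ≫ g) ⟶ X` of the square from `lam (f ≫ g)` to `f` with sides `𝟙` and `mid`,
determined by the `ℝ`-map structure of `f` and the `𝕃`-map `lam (f ≫ g)`. -/
def RMap.compP : A.E.obj (Arrow.mk (f ≫ g)) ⟶ X :=
  A.del (Arrow.mk (f ≫ g)) ≫ A.E.map (Arrow.homMk (f := A.L.obj (Arrow.mk (f ≫ g)))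
    (g := Arrow.mk f) (𝟙 X) q.mid ((Category.id_comp _).trans q.lam_mid.symm)) ≫ p.p

theorem RMap.compP_comp : p.compP q ≫ f = q.mid := by
  unfold RMap.compP
  rw [Category.assoc, Category.assoc, p.p_comp, A.rho_naturality, ← Category.assoc, A.del_rho]
  exact Category.id_comp _

theorem RMap.lam_compP : A.lam (Arrow.mk (f ≫ g)) ≫ p.compP q = 𝟙 X := by
  unfold RMap.compP
  rw [← Category.assoc, A.lam_del]
  refine (Category.assoc _ _ _).symm.trans
    ((congrArg (· ≫ p.p) (A.lam_naturality _)).trans ?_)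
  exact (Category.assoc _ _ _).trans
    ((congrArg (𝟙 X ≫ ·) p.lam_p).trans (Category.comp_id _))

theorem RMap.compP_comp_comp : p.compP q ≫ f ≫ g = A.rho (Arrow.mk (f ≫ g)) := by
  rw [← Category.assoc, p.compP_comp, q.mid_comp]

theorem RMap.mu_mid : A.mu (Arrow.mk (f ≫ g)) ≫ q.mid =
    A.E.map (Arrow.homMk (f := A.R.obj (Arrow.mk (f ≫ g))) (g := Arrow.mk (f ≫ g))
      (p.compP q) (𝟙 Z) ((p.compP_comp_comp q).trans (Category.comp_id _).symm)) ≫ q.mid := by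
  have w : q.mid (f := f) ≫ g = A.rho (Arrow.mk (f ≫ g)) ≫ 𝟙 Z :=
    q.mid_comp.trans (Category.comp_id _).symm
  trans A.E.map (Arrow.homMk (f := A.R.obj (Arrow.mk (f ≫ g))) (g := Arrow.mk g)
    q.mid (𝟙 Z) w) ≫ q.p
  · conv_lhs => unfold RMap.mid
    rw [← Category.assoc, ← A.mu_naturality, Category.assoc, q.mu_p, ← Category.assoc]
    congr 1
    exact E_comp _ _ _ rfl (Category.comp_id _)
  · conv_rhs => unfold RMap.mid
    rw [← Category.assoc]
    congr 1
    exact (E_comp _ _ _ (p.compP_comp q) (Category.comp_id _)).symm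

/-- Vertical composition of `ℝ`-maps. -/
def RMap.comp : A.RMap (f ≫ g) where
  p := p.compP q
  lam_p := p.lam_compP q
  p_comp := p.compP_comp_comp q
  mu_p := by
    have w₁ : p.compP q ≫ f =
        A.lam (A.R.obj (Arrow.mk (f ≫ g))) ≫ A.mu (Arrow.mk (f ≫ g)) ≫ q.mid := by
      rw [← Category.assoc, A.lam_mu, p.compP_comp]
      exact (Category.id_comp _).symm
    trans A.del (A.R.obj (Arrow.mk (f ≫ g))) ≫
      A.E.map (Arrow.homMk (f := A.L.obj (A.R.obj (Arrow.mk (f ≫ g)))) (g := Arrow.mk f)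
        (p.compP q) (A.mu (Arrow.mk (f ≫ g)) ≫ q.mid) w₁) ≫ p.p
    · conv_lhs => unfold RMap.compP
      rw [← Category.assoc, A.distrib, Category.assoc, Category.assoc,
        ← Category.assoc (A.mu _), ← A.mu_naturality, Category.assoc, p.mu_p]
      congr 1
      rw [← Category.assoc, ← Category.assoc]
      congr 1
      rw [Category.assoc]
      refine (congrArg (_ ≫ ·) (E_comp _ _ (Arrow.homMk
        (f := A.R.obj (A.L.obj (Arrow.mk (f ≫ g)))) (g := Arrow.mk f)
        (A.E.map (Arrow.homMk (f := A.L.obj (Arrow.mk (f ≫ g))) (g := Arrow.mk f) (𝟙 X) q.mid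
          ((Category.id_comp _).trans q.lam_mid.symm)) ≫ p.p) q.mid ?_)
        rfl (Category.comp_id _))).trans ?_
      · exact (Category.assoc _ _ _).trans
          ((congrArg (_ ≫ ·) p.p_comp).trans (A.rho_naturality _))
      · exact E_comp _ _ _ rfl rfl
    · conv_rhs => unfold RMap.compP
      rw [← Category.assoc (A.E.map _), A.del_naturality, Category.assoc]
      congr 1
      rw [← Category.assoc]
      congr 1
      exact (E_comp _ _ _ (Category.comp_id _) (p.mu_mid q).symm).symm

end RComp

/-- Transport of an `𝕃`-map structure along an equality of maps. -/
def LMap.copy {X Y : C} {f g : X ⟶ Y} (s : A.LMap f) (h : f = g) : A.LMap g := h ▸ s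

/-- Transport of an `ℝ`-map structure along an equality of maps. -/
def RMap.copy {X Y : C} {f g : X ⟶ Y} (p : A.RMap f) (h : f = g) : A.RMap g := h ▸ p

/-- A commutative square `φ : f ⟶ g` is a map of `𝕃`-coalgebras `(f, s) ⟶ (g, t)`. These are the
squares of the double category of `𝕃`-maps. -/
def LMap.IsSquare {X Y X' Y' : C} {f : X ⟶ Y} {g : X' ⟶ Y'} (s : A.LMap f) (t : A.LMap g)
    (φ : Arrow.mk f ⟶ Arrow.mk g) : Prop :=
  s.s ≫ A.E.map φ = φ.right ≫ t.s

/-- A commutative square `φ : f ⟶ g` is a map of `ℝ`-algebras `(f, p) ⟶ (g, q)`. These are the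
squares of the double category of `ℝ`-maps. -/
def RMap.IsSquare {X Y X' Y' : C} {f : X ⟶ Y} {g : X' ⟶ Y'} (p : A.RMap f) (q : A.RMap g)
    (φ : Arrow.mk f ⟶ Arrow.mk g) : Prop :=
  A.E.map φ ≫ q.p = p.p ≫ φ.left

variable (A)

/-- `∃𝕃`: the class of maps that admit an `𝕃`-map structure. -/
def existsL : MorphismProperty C := fun _ _ f => Nonempty (A.LMap f)

/-- `∃ℝ`: the class of maps that admit an `ℝ`-map structure. -/
def existsR : MorphismProperty C := fun _ _ f => Nonempty (A.RMap f)

/-! ### The underlying weak factorization system -/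

/-- The left class of the underlying weak factorization system: the maps that admit a coalgebra
structure for the copointed endofunctor `(L, eps)`. -/
def leftClass : MorphismProperty C := fun _ Y f =>
  ∃ s : Y ⟶ A.E.obj (Arrow.mk f), f ≫ s = A.lam (Arrow.mk f) ∧ s ≫ A.rho (Arrow.mk f) = 𝟙 Y

/-- The right class of the underlying weak factorization system: the maps that admit an algebra
structure for the pointed endofunctor `(R, eta)`. -/
def rightClass : MorphismProperty C := fun X _ f =>
  ∃ p : A.E.obj (Arrow.mk f) ⟶ X, A.lam (Arrow.mk f) ≫ p = 𝟙 X ∧ p ≫ f = A.rho (Arrow.mk f)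

instance : A.leftClass.IsStableUnderRetracts where
  of_retract {X Y Z W f g} h := by
    rintro ⟨s, hs₁, hs₂⟩
    refine ⟨h.i.right ≫ s ≫ A.E.map h.r, ?_, ?_⟩
    · rw [← Category.assoc, ← h.i_w, Category.assoc, ← Category.assoc g, hs₁, A.lam_naturality,
        ← Category.assoc]
      exact (congrArg (· ≫ A.lam (Arrow.mk f)) h.retract_left).trans (Category.id_comp _)
    · rw [Category.assoc, Category.assoc, A.rho_naturality, ← Category.assoc s, hs₂]
      exact (congrArg (h.i.right ≫ ·) (Category.id_comp _)).trans h.retract_right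

instance : A.rightClass.IsStableUnderRetracts where
  of_retract {X Y Z W f g} h := by
    rintro ⟨p, hp₁, hp₂⟩
    refine ⟨A.E.map h.i ≫ p ≫ h.r.left, ?_, ?_⟩
    · rw [← Category.assoc, A.lam_naturality, Category.assoc, ← Category.assoc (A.lam _), hp₁]
      exact (congrArg (h.i.left ≫ ·) (Category.id_comp _)).trans h.retract_left
    · rw [Category.assoc, Category.assoc, h.r_w, ← Category.assoc p, hp₂, ← Category.assoc,
        A.rho_naturality, Category.assoc]
      exact (congrArg (A.rho (Arrow.mk f) ≫ ·) h.retract_right).trans (Category.comp_id _)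

instance : MorphismProperty.HasFactorization A.leftClass A.rightClass where
  nonempty_mapFactorizationData f := ⟨
    { Z := A.E.obj (Arrow.mk f)
      i := A.lam (Arrow.mk f)
      p := A.rho (Arrow.mk f)
      fac := A.fac (Arrow.mk f)
      hi := ⟨A.del (Arrow.mk f), A.lam_del _, A.del_rho _⟩
      hp := ⟨A.mu (Arrow.mk f), A.lam_mu _, A.mu_rho _⟩ }⟩

/-- The underlying weak factorization system is a weak factorization system. -/
instance : MorphismProperty.IsWeakFactorizationSystem A.leftClass A.rightClass :=
  MorphismProperty.IsWeakFactorizationSystem.mk' _ _ (by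
    rintro X Y X' Y' f g ⟨s, hs₁, hs₂⟩ ⟨p, hp₁, hp₂⟩
    refine ⟨fun {a b} sq => ⟨⟨?_⟩⟩⟩
    let φ : Arrow.mk f ⟶ Arrow.mk g := Arrow.homMk a b sq.w
    refine ⟨s ≫ A.E.map φ ≫ p, ?_, ?_⟩
    · rw [← Category.assoc, hs₁, ← Category.assoc, A.lam_naturality, Category.assoc, hp₁]
      exact Category.comp_id _
    · rw [Category.assoc, Category.assoc, hp₂, A.rho_naturality, ← Category.assoc, hs₂]
      exact Category.id_comp _)

/-! ### Liftings -/

variable {K : Type u'} [Category.{v'} K]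

/-- The data exhibiting the double category of `𝕃'`-maps of `A'` as the pullback of the double
category of `𝕃`-maps of `A` along the double functor `Sq V : Sq K ⥤ Sq C`, over `Sq K`.
In components, since the objects and horizontal arrows of all these double categories are those of
the base category, and their squares are commutative squares with a property, this is:
on vertical arrows, a bijection between the `𝕃'`-map structures on `f` and the `𝕃`-map structures
on `V f`; on squares, that a commutative square of `K` is a square of `𝕃'`-maps precisely when its
image is a square of `𝕃`-maps; and compatibility with vertical identities and composition. -/
structure LeftLiftingData (V : K ⥤ C) (A' : AWFS K) where
  /-- the bijection on vertical arrows -/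
  equiv {X Y : K} (f : X ⟶ Y) : A'.LMap f ≃ A.LMap (V.map f)
  isSquare_iff {X Y X' Y' : K} {f : X ⟶ Y} {g : X' ⟶ Y'} (s : A'.LMap f) (t : A'.LMap g)
    (φ : Arrow.mk f ⟶ Arrow.mk g) :
    s.IsSquare t φ ↔ (equiv f s).IsSquare (equiv g t) (V.mapArrow.map φ)
  equiv_id (X : K) : equiv (𝟙 X) (LMap.id A' X) = (LMap.id A (V.obj X)).copy (V.map_id X).symm
  equiv_comp {X Y Z : K} {f : X ⟶ Y} {g : Y ⟶ Z} (s : A'.LMap f) (t : A'.LMap g) :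
    equiv (f ≫ g) (s.comp t) = ((equiv f s).comp (equiv g t)).copy (V.map_comp f g).symm

/-- `A'` is the left-lifting of `A` along `V`. -/
def IsLeftLifting (V : K ⥤ C) (A' : AWFS K) : Prop := Nonempty (A.LeftLiftingData V A')

/-- The data exhibiting the double category of `ℝ'`-maps of `A'` as the pullback of the double
category of `ℝ`-maps of `A` along the double functor `Sq U : Sq K ⥤ Sq C`, over `Sq K`. -/
structure RightLiftingData (U : K ⥤ C) (A' : AWFS K) where
  /-- the bijection on vertical arrows -/
  equiv {X Y : K} (f : X ⟶ Y) : A'.RMap f ≃ A.RMap (U.map f)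
  isSquare_iff {X Y X' Y' : K} {f : X ⟶ Y} {g : X' ⟶ Y'} (p : A'.RMap f) (q : A'.RMap g)
    (φ : Arrow.mk f ⟶ Arrow.mk g) :
    p.IsSquare q φ ↔ (equiv f p).IsSquare (equiv g q) (U.mapArrow.map φ)
  equiv_id (X : K) : equiv (𝟙 X) (RMap.id A' X) = (RMap.id A (U.obj X)).copy (U.map_id X).symm
  equiv_comp {X Y Z : K} {f : X ⟶ Y} {g : Y ⟶ Z} (p : A'.RMap f) (q : A'.RMap g) :
    equiv (f ≫ g) (p.comp q) = ((equiv f p).comp (equiv g q)).copy (U.map_comp f g).symm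

/-- `A'` is the right-lifting of `A` along `U`. -/
def IsRightLifting (U : K ⥤ C) (A' : AWFS K) : Prop := Nonempty (A.RightLiftingData U A')

/-- The underlying weak factorization system of `A'` is the left-lifting along `V` of the
underlying weak factorization system `(ℒ, ℛ)` of `A`, i.e. it is the pair consisting of `V⁻¹ ℒ`
and the maps with the right lifting property against `V⁻¹ ℒ`. -/
def UnderlyingIsLeftLifted (V : K ⥤ C) (A' : AWFS K) : Prop :=
  A'.leftClass = A.leftClass.inverseImage V ∧
    A'.rightClass = (A.leftClass.inverseImage V).rlp

/-- The underlying weak factorization system of `A'` is the right-lifting along `U` of the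
underlying weak factorization system `(ℒ, ℛ)` of `A`, i.e. it is the pair consisting of the maps
with the left lifting property against `U⁻¹ ℛ`, and `U⁻¹ ℛ`. -/
def UnderlyingIsRightLifted (U : K ⥤ C) (A' : AWFS K) : Prop :=
  A'.leftClass = (A.rightClass.inverseImage U).llp ∧
    A'.rightClass = A.rightClass.inverseImage U

end AWFS

/-- Part (i) of the claim: whenever a left-lifting of an algebraic weak factorization system along
a left adjoint exists, its underlying weak factorization system is the left-lifting of the
underlying weak factorization system. -/
def LeftLiftingClaim : Prop :=
  ∀ (M : Type u) [Category.{v} M] (K : Type u') [Category.{v'} K] (A : AWFS M) (V : K ⥤ M)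
    (A' : AWFS K), V.IsLeftAdjoint → A.IsLeftLifting V A' → A.UnderlyingIsLeftLifted V A'

/-- Part (ii) of the claim: the same for right-liftings along right adjoints. -/
def RightLiftingClaim : Prop :=
  ∀ (M : Type u) [Category.{v} M] (K : Type u') [Category.{v'} K] (A : AWFS M) (U : K ⥤ M)
    (A' : AWFS K), U.IsRightAdjoint → A.IsRightLifting U A' → A.UnderlyingIsRightLifted U A'

/-! ### The algebraic weak factorization system of a comonad -/

section OfComonad

variable {C : Type u} [Category.{v} C] [HasBinaryCoproducts C] (P : Comonad C)

/-- The factorization `X ⟶ X ⨿ P Y ⟶ Y` of `f : X ⟶ Y`. -/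
noncomputable def factorizationOfComonad : FunctorialFactorization C where
  E :=
    { obj := fun f => f.left ⨿ P.obj f.right
      map := fun φ => coprod.map φ.left (P.map φ.right)
      map_id := fun f => by simp
      map_comp := fun φ ψ => by simp }
  lam f := coprod.inl
  rho f := coprod.desc f.hom (P.ε.app f.right)
  fac f := coprod.inl_desc _ _
  lam_naturality φ := by simp
  rho_naturality {f g} φ := by
    ext
    · simp
    · simp

section Identities

variable {X Y X' Y' : C}

theorem ofComonad_del_naturality (a : X ⟶ X') (b : Y ⟶ Y') :
    coprod.map a (P.map b) ≫ coprod.map (𝟙 X') (P.δ.app Y' ≫ P.map coprod.inr) =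
      coprod.map (𝟙 X) (P.δ.app Y ≫ P.map coprod.inr) ≫
        coprod.map a (P.map (coprod.map a (P.map b))) := by
  have h := CategoryTheory.Comonad.delta_naturality _ P b
  rw [coprod.map_map, coprod.map_map]
  congr 1
  · simp
  · rw [← Category.assoc, h, Category.assoc, Category.assoc, ← P.map_comp, ← P.map_comp,
      coprod.inr_map]

theorem ofComonad_mu_naturality (a : X ⟶ X') (b : Y ⟶ Y') :
    coprod.map (coprod.map a (P.map b)) (P.map b) ≫
      coprod.desc (𝟙 (X' ⨿ P.obj Y')) coprod.inr =
        coprod.desc (𝟙 (X ⨿ P.obj Y)) coprod.inr ≫ coprod.map a (P.map b) := by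
  rw [coprod.map_desc, coprod.desc_comp, coprod.inr_map, Category.comp_id, Category.id_comp]

theorem ofComonad_del_rho :
    coprod.map (𝟙 X) (P.δ.app Y ≫ P.map coprod.inr) ≫
      coprod.desc coprod.inl (P.ε.app (X ⨿ P.obj Y)) = 𝟙 (X ⨿ P.obj Y) := by
  have h := CategoryTheory.Comonad.counit_naturality _ P (coprod.inr : P.obj Y ⟶ X ⨿ P.obj Y)
  rw [coprod.map_desc, Category.assoc, h, ← Category.assoc, P.left_counit, Category.id_comp,
    Category.id_comp, coprod.desc_inl_inr]

theorem ofComonad_mu_rho (f : X ⟶ Y) :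
    coprod.desc (𝟙 (X ⨿ P.obj Y)) coprod.inr ≫ coprod.desc f (P.ε.app Y) =
      coprod.desc (coprod.desc f (P.ε.app Y)) (P.ε.app Y) := by
  rw [coprod.desc_comp, Category.id_comp, coprod.inr_desc]

theorem ofComonad_del_eps (f : X ⟶ Y) :
    coprod.map (𝟙 X) (P.δ.app Y ≫ P.map coprod.inr) ≫
      coprod.map (𝟙 X) (P.map (coprod.desc f (P.ε.app Y))) = 𝟙 (X ⨿ P.obj Y) := by
  rw [coprod.map_map, Category.assoc, ← P.map_comp, coprod.inr_desc, P.right_counit,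
    Category.id_comp, coprod.map_id_id]

theorem ofComonad_eta_mu :
    coprod.map coprod.inl (P.map (𝟙 Y)) ≫ coprod.desc (𝟙 (X ⨿ P.obj Y)) coprod.inr =
      𝟙 (X ⨿ P.obj Y) := by
  rw [coprod.map_desc, P.map_id, Category.comp_id, Category.id_comp, coprod.desc_inl_inr]

theorem ofComonad_coassoc :
    coprod.map (𝟙 X) (P.δ.app Y ≫ P.map coprod.inr) ≫
        coprod.map (𝟙 X) (P.δ.app (X ⨿ P.obj Y) ≫ P.map coprod.inr) =
      coprod.map (𝟙 X) (P.δ.app Y ≫ P.map coprod.inr) ≫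
        coprod.map (𝟙 X) (P.map (coprod.map (𝟙 X) (P.δ.app Y ≫ P.map coprod.inr))) := by
  have h := CategoryTheory.Comonad.delta_naturality _ P (coprod.inr : P.obj Y ⟶ X ⨿ P.obj Y)
  have h' := P.coassoc Y
  rw [coprod.map_map, coprod.map_map]
  congr 1
  rw [Category.assoc, Category.assoc, ← Category.assoc (P.map _), h, Category.assoc,
    ← Category.assoc, ← h', Category.assoc, ← P.map_comp, ← P.map_comp, ← P.map_comp,
    coprod.inr_map, Category.assoc]

theorem ofComonad_assoc :
    coprod.desc (𝟙 ((X ⨿ P.obj Y) ⨿ P.obj Y)) coprod.inr ≫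
        coprod.desc (𝟙 (X ⨿ P.obj Y)) coprod.inr =
      coprod.map (coprod.desc (𝟙 (X ⨿ P.obj Y)) coprod.inr) (P.map (𝟙 Y)) ≫
        coprod.desc (𝟙 (X ⨿ P.obj Y)) coprod.inr := by
  rw [coprod.desc_comp, coprod.map_desc, P.map_id, Category.id_comp, Category.id_comp,
    Category.comp_id, coprod.inr_desc]

theorem ofComonad_distrib :
    coprod.desc (𝟙 (X ⨿ P.obj Y)) coprod.inr ≫
        coprod.map (𝟙 X) (P.δ.app Y ≫ P.map coprod.inr) =
      coprod.map (𝟙 (X ⨿ P.obj Y)) (P.δ.app Y ≫ P.map coprod.inr) ≫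
        coprod.map (coprod.map (𝟙 X) (P.δ.app Y ≫ P.map coprod.inr))
          (P.map (coprod.desc (𝟙 (X ⨿ P.obj Y)) coprod.inr)) ≫
        coprod.desc (𝟙 (X ⨿ P.obj (X ⨿ P.obj Y))) coprod.inr := by
  rw [coprod.map_desc, coprod.map_desc, coprod.desc_comp, coprod.inr_map, Category.id_comp,
    Category.id_comp, Category.comp_id]
  congr 1
  rw [Category.assoc, Category.assoc, ← Category.assoc (P.map _), ← P.map_comp, coprod.inr_desc]

end Identities

/-- The algebraic weak factorization system of a comonad `P` on a category with binary coproducts: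
`f : X ⟶ Y` factors as `X ⟶ X ⨿ P Y ⟶ Y`, the comultiplication filler is
`X ⨿ P Y ⟶ X ⨿ P (X ⨿ P Y)`, induced by the comultiplication of `P`, and the multiplication filler
is the codiagonal `(X ⨿ P Y) ⨿ P Y ⟶ X ⨿ P Y`. -/
noncomputable def AWFS.ofComonad : AWFS C where
  toFunctorialFactorization := factorizationOfComonad P
  del f := coprod.map (𝟙 f.left) (P.δ.app f.right ≫ P.map coprod.inr)
  mu f := coprod.desc (𝟙 (f.left ⨿ P.obj f.right)) coprod.inr
  del_naturality φ := ofComonad_del_naturality P φ.left φ.right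
  mu_naturality φ := ofComonad_mu_naturality P φ.left φ.right
  lam_del _ := (coprod.inl_map _ _).trans (Category.id_comp _)
  del_rho _ := ofComonad_del_rho P
  lam_mu _ := coprod.inl_desc _ _
  mu_rho f := ofComonad_mu_rho P f.hom
  del_eps f := ofComonad_del_eps P f.hom
  eta_mu _ := ofComonad_eta_mu P
  coassoc _ := ofComonad_coassoc P
  assoc _ := ofComonad_assoc P
  distrib _ := ofComonad_distrib P

end OfComonad

/-! ### The two examples -/

/-- `ℤ/2` as a module over `ℤ/6`. -/
noncomputable def zmodTwo : ModuleCat.{0} (ZMod 6) :=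
  letI : Algebra (ZMod 6) (ZMod 2) := ZMod.algebra' (ZMod 2) 2 (by norm_num)
  ModuleCat.of (ZMod 6) (ZMod 2)

/-- The comonad on `ℤ/6`-modules generated by the free-forgetful adjunction with sets. -/
noncomputable def moduleComonad : Comonad (ModuleCat.{0} (ZMod 6)) :=
  (ModuleCat.adj (ZMod 6)).toComonad

/-- The functor `ℤ/2 ⊗ -` on `ℤ/6`-modules. -/
noncomputable def tensorZModTwo : ModuleCat.{0} (ZMod 6) ⥤ ModuleCat.{0} (ZMod 6) :=
  MonoidalCategory.tensorLeft zmodTwo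

/-- The monoid `{1, e}` with `e * e = e`. -/
inductive IdemMonoid
  | one
  | e

namespace IdemMonoid

instance : Monoid IdemMonoid where
  one := one
  mul
    | one, y => y
    | e, _ => e
  mul_assoc := by rintro (_ | _) (_ | _) (_ | _) <;> rfl
  one_mul _ := rfl
  mul_one := by rintro (_ | _) <;> rfl

end IdemMonoid

section MSet

variable (M : Type) [Monoid M]

/-- The free `M`-set functor, sending a set `S` to `M × S` with the action on the first factor. -/
def freeMSet : Type u ⥤ Action (Type u) M where
  obj S :=
    { V := M × S
      ρ :=
        { toFun := fun m => TypeCat.ofHom fun x => (m * x.1, x.2)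
          map_one' := by
            change TypeCat.ofHom _ = 𝟙 (M × S)
            ext x <;> simp
          map_mul' := fun m n => by
            change TypeCat.ofHom _ = (TypeCat.ofHom _ ≫ TypeCat.ofHom _ : M × S ⟶ M × S)
            ext x <;> simp [mul_assoc] } }
  map {S T} f :=
    { hom := TypeCat.ofHom fun x => (x.1, f x.2)
      comm := fun m => rfl }
  map_id S := rfl
  map_comp f g := rfl

/-- The free-forgetful adjunction between `M`-sets and sets. -/
def freeMSetAdj : freeMSet.{u} M ⊣ Action.forget (Type u) M :=
  Adjunction.mkOfUnitCounit
    { unit :=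
        { app := fun S => TypeCat.ofHom fun x => ((1 : M), x)
          naturality := fun S T f => rfl }
      counit :=
        { app := fun X =>
            { hom := TypeCat.ofHom fun x : M × X.V => X.ρ x.1 x.2
              comm := fun m => by
                ext x
                exact congrArg (fun h : End X.V => h x.2) (X.ρ.map_mul m x.1) }
          naturality := fun X Y f => by
            ext x
            exact congrArg (fun h : X.V ⟶ Y.V => h x.2) (f.comm x.1).symm }
      left_triangle := by
        ext S x
        exact Prod.ext (mul_one x.1) rfl
      right_triangle := by
        ext X x
        exact congrArg (fun h : End X.V => h x) X.ρ.map_one }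

/-- The comonad on `M`-sets generated by the free-forgetful adjunction with sets. -/
def mSetComonad : Comonad (Action (Type u) M) := (freeMSetAdj.{u} M).toComonad

/-- The functor endowing each set with its trivial `M`-action. -/
def trivialMSet : Type u ⥤ Action (Type u) M where
  obj X := Action.trivial M X
  map f :=
    { hom := f
      comm := fun m => by ext x; rfl }

end MSet

end AWFSLifting

open AWFSLifting

/-!
For any algebraic weak factorization system, a coalgebra for the copointed endofunctor `L` on `f`
exhibits `f` as a retract of the `𝕃`-map `L f`, so the underlying left class is `Retr(∃𝕃)`
(`AWFS.leftClass_eq_retracts`). For a left-lifting `∃𝕃' = V⁻¹(∃𝕃)`, and as the right class of a weak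
factorization system is determined by the left class, comparing the two weak factorization systems
amounts to comparing `Retr(V⁻¹(∃𝕃))` with `V⁻¹(Retr(∃𝕃))`
(`AWFS.IsLeftLifting.underlyingIsLeftLifted_iff`).

In both examples the difference is that between projective and free objects. For the comonad `P` of
a free-forgetful adjunction with sets, an `𝕃`-map `X ⟶ Y` attaches free generators to `X`, while
`∅ ⟶ Y` belongs to the underlying left class as soon as the counit `P Y ⟶ Y` has a section. The
values of `V` satisfy an identity which fails for free generators: they are annihilated by `2`,
respectively fixed by `e`. Hence no generators can be attached, and an `𝕃`-map of the form `V f` is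
an isomorphism (`AWFS.LMap.epi_of_ne_generator` and `AWFS.LMap.mono_of_ofComonad`). So
`V⁻¹(∃𝕃)` consists of the maps inverted by `V`, a class closed under retracts. On the other hand
`ℤ/2 ⊗ ℤ/6`, being a retract of `ℤ/6`, is projective, and so is every set with trivial action of
`{1, e}`, with the section `x ↦ (e, x)` of the counit.

Since an isomorphism has exactly one structure of `𝕃`-map, the left-lifting exists as soon as the
maps inverted by `V` are the left maps of an idempotent algebraic weak factorization system
(`AWFS.isLeftLifting_of_idempotent`). For sets this is the factorization `f = 𝟙 ≫ f`, and for
`ℤ/6`-modules the factorization through the product of the `2`-primary part of the source and the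
`3`-primary part of the target.

The claim on right-liftings fails by duality: the opposite of a left-lifting is a right-lifting
(`AWFS.IsLeftLifting.op`).
-/

namespace AWFSLifting

namespace AWFS

/-! ### The underlying weak factorization system of a left-lifting -/

section Underlying

variable {C : Type u} [Category.{v} C] (A : AWFS C)

theorem existsL_le_leftClass : A.existsL ≤ A.leftClass := by
  rintro X Y f ⟨s⟩
  exact ⟨s.s, s.comp_s, s.s_rho⟩

/-- The cofree coalgebra on `f`: the left factor of any map is an `𝕃`-map. -/
theorem existsL_lam (f : Arrow C) : A.existsL (A.lam f) :=
  ⟨{ s := A.del f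
     comp_s := A.lam_del f
     s_rho := A.del_rho f
     s_del := A.coassoc f }⟩

/-- A coalgebra `f ⟶ L f` for the copointed endofunctor `L` exhibits `f` as a retract of the
`𝕃`-map `L f`. -/
theorem leftClass_eq_retracts : A.leftClass = A.existsL.retracts := by
  apply le_antisymm
  · rintro X Y f ⟨s, hs₁, hs₂⟩
    let r : RetractArrow f (A.lam (Arrow.mk f)) :=
      { i := Arrow.homMk (f := Arrow.mk f) (g := Arrow.mk (A.lam (Arrow.mk f))) (𝟙 X) s
          ((Category.id_comp _).trans hs₁.symm)
        r := Arrow.homMk (f := Arrow.mk (A.lam (Arrow.mk f))) (g := Arrow.mk f) (𝟙 X)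
          (A.rho (Arrow.mk f)) ((Category.id_comp _).trans (A.fac (Arrow.mk f)).symm)
        retract := by
          ext
          · exact Category.id_comp _
          · exact hs₂ }
    exact ⟨_, _, _, r, A.existsL_lam (Arrow.mk f)⟩
  · rw [MorphismProperty.retracts_le_iff]
    exact A.existsL_le_leftClass

variable {A} {K : Type u'} [Category.{v'} K] {V : K ⥤ C} {A' : AWFS K}

theorem IsLeftLifting.existsL_eq (h : A.IsLeftLifting V A') :
    A'.existsL = A.existsL.inverseImage V := by
  obtain ⟨d⟩ := h
  ext X Y f
  exact (d.equiv f).nonempty_congr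

theorem retracts_inverseImage_existsL_le :
    (A.existsL.inverseImage V).retracts ≤ A.existsL.retracts.inverseImage V := by
  rintro X Y f ⟨X', Y', g, r, hg⟩
  exact ⟨_, _, _, Retract.map r V.mapArrow, hg⟩

theorem IsLeftLifting.underlyingIsLeftLifted_iff (h : A.IsLeftLifting V A') :
    A.UnderlyingIsLeftLifted V A' ↔
      (A.existsL.inverseImage V).retracts = A.existsL.retracts.inverseImage V := by
  have hl : A'.leftClass = (A.existsL.inverseImage V).retracts := by
    rw [A'.leftClass_eq_retracts, h.existsL_eq]
  have hr : A'.rightClass = A'.leftClass.rlp :=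
    (MorphismProperty.rlp_eq_of_wfs A'.leftClass A'.rightClass).symm
  unfold UnderlyingIsLeftLifted
  rw [hr, hl, A.leftClass_eq_retracts]
  exact ⟨fun h => h.1, fun h => ⟨h, by rw [h]⟩⟩

end Underlying

/-! ### Idempotent algebraic weak factorization systems -/

section Idempotent

variable {C : Type u} [Category.{v} C]

theorem comp_section_eq {X Y X' Y' : C} {d : X ⟶ X'} {r : X' ⟶ X} {d' : Y ⟶ Y'} {r' : Y' ⟶ Y}
    {a : X ⟶ Y} {b : X' ⟶ Y'} (h : d ≫ r = 𝟙 X) (h' : r' ≫ d' = 𝟙 Y') (w : b ≫ r' = r ≫ a) :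
    a ≫ d' = d ≫ b := by
  rw [← Category.id_comp a, ← h, Category.assoc, Category.assoc, ← Category.assoc r, ← w,
    Category.assoc, h', Category.comp_id]

theorem comp_section_eq_comp_comp {P P' Q Q' S : C} {m : P ⟶ Q} {d : Q ⟶ Q'} {r : Q' ⟶ Q}
    {d' : P ⟶ P'} {r' : P' ⟶ P} {x : P' ⟶ S} {m' : S ⟶ Q'} {t : S ⟶ Q} (h : r ≫ d = 𝟙 Q')
    (h' : d' ≫ r' = 𝟙 P) (ht : m' ≫ r = t) (w : x ≫ t = r' ≫ m) : m ≫ d = d' ≫ x ≫ m' := by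
  rw [← Category.id_comp m, ← h', Category.assoc, Category.assoc, ← Category.assoc r', ← w, ← ht,
    Category.assoc, Category.assoc, h, Category.comp_id]

/-- The algebraic weak factorization system of a functorial factorization whose copointed
endofunctor `L` is well-copointed and idempotent and whose pointed endofunctor `R` is well-pointed
and idempotent: `rho (L f)` coincides with the image under `E` of the counit and has an inverse
`del f`, and `lam (R f)` coincides with the image under `E` of the unit and has an inverse
`mu f`. -/
def ofIdempotent (F : FunctorialFactorization C)
    (hε : ∀ f, F.E.map (F.eps.app f) = F.rho (F.L.obj f))
    (hη : ∀ f, F.E.map (F.eta.app f) = F.lam (F.R.obj f))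
    (del : ∀ f, F.E.obj f ⟶ F.E.obj (F.L.obj f)) (mu : ∀ f, F.E.obj (F.R.obj f) ⟶ F.E.obj f)
    (del_rho : ∀ f, del f ≫ F.rho (F.L.obj f) = 𝟙 _)
    (rho_del : ∀ f, F.rho (F.L.obj f) ≫ del f = 𝟙 _)
    (lam_mu : ∀ f, F.lam (F.R.obj f) ≫ mu f = 𝟙 _)
    (mu_lam : ∀ f, mu f ≫ F.lam (F.R.obj f) = 𝟙 _) : AWFS C :=
  have lam_del : ∀ f, F.lam f ≫ del f = F.lam (F.L.obj f) := fun f => by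
    refine (congrArg (· ≫ del f) (F.fac (F.L.obj f)).symm).trans ?_
    refine (Category.assoc _ _ _).trans ?_
    exact (congrArg (F.lam (F.L.obj f) ≫ ·) (rho_del f)).trans (Category.comp_id _)
  have mu_rho : ∀ f, mu f ≫ F.rho f = F.rho (F.R.obj f) := fun f => by
    refine (congrArg (mu f ≫ ·) (F.fac (F.R.obj f)).symm).trans ?_
    refine (Category.assoc _ _ _).symm.trans ?_
    exact (congrArg (· ≫ F.rho (F.R.obj f)) (mu_lam f)).trans (Category.id_comp _)
  { toFunctorialFactorization := F
    del := del
    mu := mu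
    del_naturality := fun {f g} φ => by
      exact comp_section_eq (del_rho f) (rho_del g) (F.rho_naturality (F.L.map φ))
    mu_naturality := fun {f g} φ => by
      exact comp_section_eq (mu_lam f) (lam_mu g) (F.lam_naturality (F.R.map φ)).symm
    lam_del := lam_del
    del_rho := del_rho
    lam_mu := lam_mu
    mu_rho := mu_rho
    del_eps := fun f => (congrArg (del f ≫ ·) (hε f)).trans (del_rho f)
    eta_mu := fun f => (congrArg (· ≫ mu f) (hη f)).trans (lam_mu f)
    coassoc := fun f => by
      congr 1
      -- `E (1, del f)` is inverse to `E (eps (L f))`, of which `del (L f)` is a section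
      have h : F.E.map (F.eps.app (F.L.obj f)) ≫ F.E.map (Arrow.homMk (f := F.L.obj f)
          (g := F.L.obj (F.L.obj f)) (𝟙 f.left) (del f)
          ((Category.id_comp _).trans (lam_del f).symm)) = 𝟙 _ := by
        rw [← F.E.map_comp, ← F.E.map_id]
        congr 1
        ext
        · exact Category.id_comp _
        · exact rho_del f
      calc
        del (F.L.obj f) = del (F.L.obj f) ≫ 𝟙 _ := (Category.comp_id _).symm
        _ = _ := congrArg (del (F.L.obj f) ≫ ·) h.symm
        _ = _ := (Category.assoc _ _ _).symm
        _ = 𝟙 _ ≫ _ := congrArg (· ≫ _)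
          ((congrArg (del (F.L.obj f) ≫ ·) (hε (F.L.obj f))).trans (del_rho (F.L.obj f)))
        _ = _ := Category.id_comp _
    assoc := fun f => by
      congr 1
      -- `E (mu f, 1)` is inverse to `E (eta (R f))`, of which `mu (R f)` is a retraction
      have h : F.E.map (Arrow.homMk (f := F.R.obj (F.R.obj f)) (g := F.R.obj f)
          (mu f) (𝟙 f.right) ((mu_rho f).trans (Category.comp_id _).symm)) ≫
          F.E.map (F.eta.app (F.R.obj f)) = 𝟙 _ := by
        rw [← F.E.map_comp, ← F.E.map_id]
        congr 1
        ext
        · exact mu_lam f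
        · exact Category.id_comp _
      calc
        mu (F.R.obj f) = 𝟙 _ ≫ mu (F.R.obj f) := (Category.id_comp _).symm
        _ = _ := congrArg (· ≫ mu (F.R.obj f)) h.symm
        _ = _ := Category.assoc _ _ _
        _ = _ ≫ 𝟙 _ := congrArg (_ ≫ ·)
          ((congrArg (· ≫ mu (F.R.obj f)) (hη (F.R.obj f))).trans (lam_mu (F.R.obj f)))
        _ = _ := Category.comp_id _
    distrib := fun f => by
      -- `rho (L f)` is invertible, so it suffices to compare composites with it, and these are
      -- computed by naturality of `rho`
      exact comp_section_eq_comp_comp (rho_del f) (del_rho (F.R.obj f)) (mu_rho (F.L.obj f))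
        (F.rho_naturality (Arrow.homMk (f := F.L.obj (F.R.obj f)) (g := F.R.obj (F.L.obj f))
          (del f) (mu f) ((del_rho f).trans (lam_mu f).symm))) }

variable {A : AWFS C}

/-- The coalgebra structures for an idempotent comonad are the inverses of its counit. -/
theorem LMap.rho_s_of_idempotent (hε : ∀ f, A.E.map (A.eps.app f) = A.rho (A.L.obj f))
    {X Y : C} {f : X ⟶ Y} (s : A.LMap f) : A.rho (Arrow.mk f) ≫ s.s = 𝟙 _ := by
  have w : 𝟙 X ≫ A.lam (Arrow.mk f) = f ≫ s.s := (Category.id_comp _).trans s.comp_s.symm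
  have h₁ := A.rho_naturality
    (Arrow.homMk (f := Arrow.mk f) (g := A.L.obj (Arrow.mk f)) (𝟙 X) s.s w)
  refine h₁.symm.trans ((congrArg (_ ≫ ·) (hε (Arrow.mk f)).symm).trans ?_)
  exact (E_comp _ _ (𝟙 _) (Category.id_comp _) s.s_rho).trans (A.E.map_id _)

/-- The inverse `r` of an invertible `rho f`, as a coalgebra structure on `f`. -/
def LMap.ofInverseRho {X Y : C} (f : X ⟶ Y) (r : Y ⟶ A.E.obj (Arrow.mk f))
    (h₁ : A.rho (Arrow.mk f) ≫ r = 𝟙 _) (h₂ : r ≫ A.rho (Arrow.mk f) = 𝟙 Y) : A.LMap f :=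
  have w : f ≫ r = A.lam (Arrow.mk f) :=
    (congrArg (· ≫ r) (A.fac (Arrow.mk f)).symm).trans ((Category.assoc _ _ _).trans
      ((congrArg (A.lam (Arrow.mk f) ≫ ·) h₁).trans (Category.comp_id _)))
  { s := r
    comp_s := w
    s_rho := h₂
    s_del := by
      congr 1
      -- `E (1, r)` is inverse to `E (eps f)`, of which `del f` is a section
      have h := E_comp (A := A) (A.eps.app (Arrow.mk f))
        (Arrow.homMk (f := Arrow.mk f) (g := A.L.obj (Arrow.mk f)) (𝟙 X) r
          ((Category.id_comp _).trans w.symm)) (𝟙 _) (Category.id_comp _) h₁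
      rw [A.E.map_id] at h
      calc
        A.del (Arrow.mk f) = A.del (Arrow.mk f) ≫ 𝟙 _ := (Category.comp_id _).symm
        _ = _ := congrArg (A.del (Arrow.mk f) ≫ ·) h.symm
        _ = _ := (Category.assoc _ _ _).symm
        _ = 𝟙 _ ≫ _ := congrArg (· ≫ _) (A.del_eps (Arrow.mk f))
        _ = _ := Category.id_comp _ }

theorem LMap.isIso_rho (hε : ∀ f, A.E.map (A.eps.app f) = A.rho (A.L.obj f))
    {X Y : C} {f : X ⟶ Y} (s : A.LMap f) : IsIso (A.rho (Arrow.mk f)) :=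
  ⟨s.s, s.rho_s_of_idempotent hε, s.s_rho⟩

theorem subsingleton_lMap_of_idempotent (hε : ∀ f, A.E.map (A.eps.app f) = A.rho (A.L.obj f))
    {X Y : C} (f : X ⟶ Y) : Subsingleton (A.LMap f) := by
  refine ⟨fun s t => ?_⟩
  have := s.isIso_rho hε
  ext
  rw [← cancel_epi (A.rho (Arrow.mk f)), s.rho_s_of_idempotent hε, t.rho_s_of_idempotent hε]

theorem LMap.isSquare_of_idempotent (hε : ∀ f, A.E.map (A.eps.app f) = A.rho (A.L.obj f))
    {X Y X' Y' : C} {f : X ⟶ Y} {g : X' ⟶ Y'} (s : A.LMap f) (t : A.LMap g)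
    (φ : Arrow.mk f ⟶ Arrow.mk g) : s.IsSquare t φ := by
  have := s.isIso_rho hε
  unfold LMap.IsSquare
  rw [← cancel_epi (A.rho (Arrow.mk f)), ← Category.assoc, s.rho_s_of_idempotent hε,
    ← Category.assoc]
  refine (Category.id_comp _).trans ?_
  refine Eq.trans ?_ (congrArg (· ≫ t.s) (A.rho_naturality φ))
  rw [Category.assoc, t.rho_s_of_idempotent hε, Category.comp_id]

end Idempotent

section Iso

variable {C : Type u} [Category.{v} C] {A : AWFS C}

/-- In any algebraic weak factorization system an isomorphism is an `𝕃`-map. -/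
noncomputable def LMap.ofIsIso {X Y : C} (f : X ⟶ Y) [IsIso f] : A.LMap f where
  s := inv f ≫ A.lam (Arrow.mk f)
  comp_s := IsIso.hom_inv_id_assoc _ _
  s_rho := by
    rw [Category.assoc, A.fac]
    exact IsIso.inv_hom_id f
  s_del := by
    rw [Category.assoc, Category.assoc, A.lam_del, A.lam_naturality]
    exact congrArg (inv f ≫ ·) (Category.id_comp _).symm

theorem LMap.s_eq_of_isIso {X Y : C} {f : X ⟶ Y} [IsIso f] (s : A.LMap f) :
    s.s = inv f ≫ A.lam (Arrow.mk f) := by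
  rw [IsIso.eq_inv_comp, s.comp_s]

theorem LMap.isSquare_of_isIso {X Y X' Y' : C} {f : X ⟶ Y} {g : X' ⟶ Y'} [IsIso f] [IsIso g]
    (s : A.LMap f) (t : A.LMap g) (φ : Arrow.mk f ⟶ Arrow.mk g) : s.IsSquare t φ := by
  unfold LMap.IsSquare
  rw [s.s_eq_of_isIso, Category.assoc, IsIso.inv_comp_eq, A.lam_naturality, t.s_eq_of_isIso]
  have h : f ≫ φ.right = φ.left ≫ g := φ.w.symm
  rw [← Category.assoc f, h, Category.assoc, IsIso.hom_inv_id_assoc]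

/-- If the only `𝕃`-maps in the image of `V` are isomorphisms, then an algebraic weak factorization
system with idempotent comonad whose left maps are those inverted by `V` is the left-lifting
along `V`: all the structures involved are unique. -/
theorem isLeftLifting_of_idempotent {K : Type u'} [Category.{v'} K] {V : K ⥤ C}
    {A' : AWFS K} (hε : ∀ f, A'.E.map (A'.eps.app f) = A'.rho (A'.L.obj f))
    (hV : ∀ {X Y : K} (f : X ⟶ Y), IsIso (A'.rho (Arrow.mk f)) ↔ IsIso (V.map f))
    (hA : ∀ {X Y : K} (f : X ⟶ Y), A.LMap (V.map f) → IsIso (V.map f)) :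
    A.IsLeftLifting V A' := by
  have hs : ∀ {X Y : K} (f : X ⟶ Y), Subsingleton (A.LMap (V.map f)) := fun f =>
    ⟨fun s t => by
      have := hA f s
      ext
      rw [s.s_eq_of_isIso, t.s_eq_of_isIso]⟩
  refine ⟨{ equiv := fun f =>
              { toFun := fun s =>
                  haveI := (hV f).1 (s.isIso_rho hε)
                  LMap.ofIsIso (V.map f)
                invFun := fun s =>
                  haveI := (hV f).2 (hA f s)
                  LMap.ofInverseRho f (inv (A'.rho (Arrow.mk f))) (IsIso.hom_inv_id _)
                    (IsIso.inv_hom_id _)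
                left_inv := fun _ => (subsingleton_lMap_of_idempotent hε f).elim _ _
                right_inv := fun _ => (hs f).elim _ _ }
            isSquare_iff := fun {X Y X' Y' f g} s t φ => ?_
            equiv_id := fun X => (hs _).elim _ _
            equiv_comp := fun s t => (hs _).elim _ _ }⟩
  have := (hV f).1 (s.isIso_rho hε)
  have := (hV g).1 (t.isIso_rho hε)
  exact iff_of_true (s.isSquare_of_idempotent hε t φ) (LMap.isSquare_of_isIso _ _ _)

end Iso

end AWFS

/-! ### The opposite algebraic weak factorization system -/

section Op

variable {C : Type u} [Category.{v} C]

/-- The arrow of `C` underlying an arrow of `Cᵒᵖ`. -/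
abbrev unopArrow (f : Arrow Cᵒᵖ) : Arrow C := Arrow.mk f.hom.unop

/-- The square of `C` underlying a square of `Cᵒᵖ`. -/
abbrev unopSquare {f g : Arrow Cᵒᵖ} (φ : f ⟶ g) : unopArrow g ⟶ unopArrow f :=
  Arrow.homMk (f := unopArrow g) (g := unopArrow f) φ.right.unop φ.left.unop
    (congrArg Quiver.Hom.unop φ.w.symm)

/-- The factorization of the opposite category, with left and right factors interchanged. -/
def FunctorialFactorization.op (F : FunctorialFactorization C) : FunctorialFactorization Cᵒᵖ where
  E :=
    { obj := fun f => Opposite.op (F.E.obj (unopArrow f))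
      map := fun φ => (F.E.map (unopSquare φ)).op
      map_id := fun f => congrArg Quiver.Hom.op (F.E.map_id (unopArrow f))
      map_comp := fun φ ψ =>
        congrArg Quiver.Hom.op (F.E.map_comp (unopSquare ψ) (unopSquare φ)) }
  lam f := (F.rho (unopArrow f)).op
  rho f := (F.lam (unopArrow f)).op
  fac f := congrArg Quiver.Hom.op (F.fac (unopArrow f))
  lam_naturality φ := congrArg Quiver.Hom.op (F.rho_naturality (unopSquare φ))
  rho_naturality φ := congrArg Quiver.Hom.op (F.lam_naturality (unopSquare φ))

namespace AWFS

/-- The algebraic weak factorization system of the opposite category, with the comonad and the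
monad interchanged. -/
def op (A : AWFS C) : AWFS Cᵒᵖ where
  toFunctorialFactorization := A.toFunctorialFactorization.op
  del f := (A.mu (unopArrow f)).op
  mu f := (A.del (unopArrow f)).op
  del_naturality φ := congrArg Quiver.Hom.op (A.mu_naturality (unopSquare φ)).symm
  mu_naturality φ := congrArg Quiver.Hom.op (A.del_naturality (unopSquare φ)).symm
  lam_del f := congrArg Quiver.Hom.op (A.mu_rho (unopArrow f))
  del_rho f := congrArg Quiver.Hom.op (A.lam_mu (unopArrow f))
  lam_mu f := congrArg Quiver.Hom.op (A.del_rho (unopArrow f))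
  mu_rho f := congrArg Quiver.Hom.op (A.lam_del (unopArrow f))
  del_eps f := congrArg Quiver.Hom.op (A.eta_mu (unopArrow f))
  eta_mu f := congrArg Quiver.Hom.op (A.del_eps (unopArrow f))
  coassoc f := congrArg Quiver.Hom.op (A.assoc (unopArrow f))
  assoc f := congrArg Quiver.Hom.op (A.coassoc (unopArrow f))
  distrib f := congrArg Quiver.Hom.op
    ((A.distrib (unopArrow f)).trans (Category.assoc _ _ _).symm)

variable (A : AWFS C)

/-- The `𝕃`-map structures on `f` are the `ℝ`-map structures on `f.op`. -/
def lMapEquivOp {X Y : C} (f : X ⟶ Y) : A.LMap f ≃ A.op.RMap f.op where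
  toFun s :=
    { p := s.s.op
      lam_p := congrArg Quiver.Hom.op s.s_rho
      p_comp := congrArg Quiver.Hom.op s.comp_s
      mu_p := congrArg Quiver.Hom.op s.s_del }
  invFun p :=
    { s := p.p.unop
      comp_s := congrArg Quiver.Hom.unop p.p_comp
      s_rho := congrArg Quiver.Hom.unop p.lam_p
      s_del := congrArg Quiver.Hom.unop p.mu_p }
  left_inv _ := rfl
  right_inv _ := rfl

variable {A}

theorem lMapEquivOp_copy {X Y : C} {f g : X ⟶ Y} (s : A.LMap f) (h : f = g) :
    A.lMapEquivOp g (s.copy h) = (A.lMapEquivOp f s).copy (congrArg Quiver.Hom.op h) := by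
  subst h
  rfl

theorem lMapEquivOp_comp {X Y Z : C} {f : X ⟶ Y} {g : Y ⟶ Z} (s : A.LMap f) (t : A.LMap g) :
    A.lMapEquivOp (f ≫ g) (s.comp t) =
      (A.lMapEquivOp g t).comp (A.lMapEquivOp f s) := by
  ext
  exact congrArg Quiver.Hom.op (Category.assoc _ _ _).symm

theorem lMapEquivOp_symm_comp {X Y Z : Cᵒᵖ} {f : X ⟶ Y} {g : Y ⟶ Z} (p : A.op.RMap f)
    (q : A.op.RMap g) : (A.lMapEquivOp (g.unop ≫ f.unop)).symm (p.comp q) =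
      ((A.lMapEquivOp g.unop).symm q).comp ((A.lMapEquivOp f.unop).symm p) := by
  ext
  exact Category.assoc _ _ _

theorem lMapEquivOp_isSquare {X Y X' Y' : C} {f : X ⟶ Y} {g : X' ⟶ Y'} (s : A.LMap f)
    (t : A.LMap g) (φ : Arrow.mk g.op ⟶ Arrow.mk f.op) :
    (A.lMapEquivOp g t).IsSquare (A.lMapEquivOp f s) φ ↔ s.IsSquare t (unopSquare φ) :=
  ⟨fun h => congrArg Quiver.Hom.unop h, fun h => congrArg Quiver.Hom.op h⟩

variable {K : Type u'} [Category.{v'} K] {V : K ⥤ C} {A' : AWFS K}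

/-- Left-liftings along `V` are right-liftings of the opposite systems along `V.op`. -/
theorem IsLeftLifting.op (h : A.IsLeftLifting V A') : A.op.IsRightLifting V.op A'.op := by
  obtain ⟨d⟩ := h
  let e : ∀ {X Y : Kᵒᵖ} (f : X ⟶ Y), A'.op.RMap f ≃ A.op.RMap (V.op.map f) := fun f =>
    (A'.lMapEquivOp f.unop).symm.trans
      ((d.equiv f.unop).trans (A.lMapEquivOp (V.map f.unop)))
  refine ⟨{ equiv := e, isSquare_iff := ?_, equiv_id := ?_, equiv_comp := ?_ }⟩
  · intro X Y X' Y' f g p q φ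
    have h₁ := lMapEquivOp_isSquare ((A'.lMapEquivOp g.unop).symm q)
      ((A'.lMapEquivOp f.unop).symm p) φ
    have h₂ := lMapEquivOp_isSquare (d.equiv g.unop ((A'.lMapEquivOp g.unop).symm q))
      (d.equiv f.unop ((A'.lMapEquivOp f.unop).symm p)) (V.op.mapArrow.map φ)
    exact h₁.trans ((d.isSquare_iff _ _ _).trans h₂.symm)
  · intro X
    exact (congrArg (A.lMapEquivOp _) (d.equiv_id X.unop)).trans (lMapEquivOp_copy _ _)
  · intro X Y Z f g p q
    refine (congrArg (fun s => A.lMapEquivOp _ (d.equiv _ s)) (lMapEquivOp_symm_comp p q)).trans ?_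
    refine (congrArg (A.lMapEquivOp _) (d.equiv_comp _ _)).trans ?_
    refine (lMapEquivOp_copy _ _).trans ?_
    exact congrArg (fun s => RMap.copy s _) (lMapEquivOp_comp _ _)

theorem leftClass_iff_op_rightClass {X Y : C} (f : X ⟶ Y) :
    A.leftClass f ↔ A.op.rightClass f.op :=
  ⟨fun ⟨s, h₁, h₂⟩ => ⟨s.op, congrArg Quiver.Hom.op h₂, congrArg Quiver.Hom.op h₁⟩,
    fun ⟨p, h₁, h₂⟩ => ⟨p.unop, congrArg Quiver.Hom.unop h₂, congrArg Quiver.Hom.unop h₁⟩⟩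

theorem UnderlyingIsRightLifted.leftClass_eq (h : A.op.UnderlyingIsRightLifted V.op A'.op) :
    A'.leftClass = A.leftClass.inverseImage V := by
  ext X Y f
  rw [leftClass_iff_op_rightClass, h.2]
  exact (leftClass_iff_op_rightClass (V.map f)).symm

/-- A counterexample to the claim on left-liftings gives a counterexample to the claim on
right-liftings, by passing to opposite categories. -/
theorem IsLeftLifting.not_rightLiftingClaim {M : Type u} [Category.{v} M] {K : Type u'}
    [Category.{v'} K] {A : AWFS M} {V : K ⥤ M} {A' : AWFS K} (hV : V.IsLeftAdjoint)
    (h : A.IsLeftLifting V A') (hA : ¬ A.UnderlyingIsLeftLifted V A') :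
    ¬ RightLiftingClaim.{v, u, v', u'} := fun H => by
  have e := (H Mᵒᵖ Kᵒᵖ A.op V.op A'.op inferInstance h.op).leftClass_eq
  refine hA ⟨e, ?_⟩
  rw [← e, MorphismProperty.rlp_eq_of_wfs A'.leftClass A'.rightClass]

end AWFS

end Op

/-! ### Coalgebras for the comonad of a free-forgetful adjunction -/

section Free

variable {C : Type u} [Category.{v} C] {F : Type w ⥤ C} {U : C ⥤ Type w} (adj : F ⊣ U)

/-- The map out of the free object `P Y` determined by its values on the generators. -/
def freeLift {Y T : C} (u : U.obj Y ⟶ U.obj T) : adj.toComonad.obj Y ⟶ T :=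
  (adj.homEquiv _ _).symm u

theorem map_freeLift {X Y T : C} (f : X ⟶ Y) (u : U.obj Y ⟶ U.obj T) :
    adj.toComonad.map f ≫ freeLift adj u = freeLift adj (U.map f ≫ u) :=
  (adj.homEquiv_naturality_left_symm _ _).symm

theorem counit_comp_eq_freeLift {Y T : C} (χ : Y ⟶ T) :
    adj.toComonad.ε.app Y ≫ χ = freeLift adj (U.map χ) := by
  refine ((adj.homEquiv_counit _ _ _).trans ?_).symm
  exact adj.counit.naturality χ

theorem delta_freeLift {Y T : C} (u : U.obj (adj.toComonad.obj Y) ⟶ U.obj T) :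
    adj.toComonad.δ.app Y ≫ freeLift adj u = freeLift adj (adj.unit.app (U.obj Y) ≫ u) :=
  (adj.homEquiv_naturality_left_symm _ _).symm

variable [HasBinaryCoproducts C]

/-- Let `P` be the comonad generated by a free-forgetful adjunction with sets, and let `s` be a
structure of `𝕃`-map on `f : X ⟶ Y` such that no value of `s : Y ⟶ X ⨿ P Y` is one of the free
generators of `P Y`. Then `f` is an epimorphism. Indeed, given `χ₁` and `χ₂` on `Y` with
`f ≫ χ₁ = f ≫ χ₂`, the map `χᵢ = s ≫ rho ≫ χᵢ` can be rewritten, by coassociativity of `s`, in terms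
of `u ∘ s` for any function `u` on `X ⨿ P Y` whose value at the generator `y` is `χᵢ y`. The
function `u` can be chosen independently of `i` away from the generators. -/
theorem AWFS.LMap.epi_of_ne_generator {X Y : C} {f : X ⟶ Y}
    (s : (AWFS.ofComonad adj.toComonad).LMap f)
    (hs : ∀ y y₀ : U.obj Y, U.map s.s y ≠
      U.map (coprod.inr : adj.toComonad.obj Y ⟶ X ⨿ adj.toComonad.obj Y)
        (adj.unit.app (U.obj Y) y₀)) : Epi f := by
  classical
  let P := adj.toComonad
  let s' : Y ⟶ X ⨿ P.obj Y := s.s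
  let g : U.obj Y ⟶ U.obj (X ⨿ P.obj Y) :=
    adj.unit.app (U.obj Y) ≫ U.map (coprod.inr : P.obj Y ⟶ X ⨿ P.obj Y)
  let r : X ⨿ P.obj Y ⟶ Y := coprod.desc f (P.ε.app Y)
  refine ⟨fun {T} χ₁ χ₂ hχ => ?_⟩
  have key : ∀ (χ : Y ⟶ T) (u : U.obj (X ⨿ P.obj Y) ⟶ U.obj T), g ≫ u = U.map χ →
      χ = s' ≫ coprod.desc (f ≫ χ) (freeLift adj (U.map s' ≫ u)) := by
    intro χ u hu
    have h₁ : s' ≫ r = 𝟙 Y := s.s_rho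
    have h₂ : s' ≫ coprod.map (𝟙 X) (P.δ.app Y ≫ P.map coprod.inr) =
      s' ≫ coprod.map (𝟙 X) (P.map s') := s.s_del
    have h₃ : (P.δ.app Y ≫ P.map coprod.inr) ≫
        freeLift adj u = P.ε.app Y ≫ χ := by
      rw [Category.assoc, map_freeLift, delta_freeLift, counit_comp_eq_freeLift, ← hu,
        Category.assoc]
      rfl
    calc
      χ = (s' ≫ r) ≫ χ := by rw [h₁, Category.id_comp]
      _ = s' ≫ coprod.desc (f ≫ χ) (P.ε.app Y ≫ χ) := by rw [Category.assoc, coprod.desc_comp]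
      _ = (s' ≫ coprod.map (𝟙 X) (P.δ.app Y ≫ P.map coprod.inr)) ≫
          coprod.desc (f ≫ χ) (freeLift adj u) := by
        rw [Category.assoc, coprod.map_desc, h₃, Category.id_comp]
      _ = _ := by
        rw [h₂, Category.assoc, coprod.map_desc, Category.id_comp,
          map_freeLift]
  let u : (Y ⟶ T) → (U.obj (X ⨿ P.obj Y) ⟶ U.obj T) := fun χ => TypeCat.ofHom fun z =>
    if z ∈ Set.range g then U.map χ (U.map r z) else U.map χ₁ (U.map r z)
  have hgr : g ≫ U.map r = 𝟙 (U.obj Y) := by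
    have h : (coprod.inr : P.obj Y ⟶ X ⨿ P.obj Y) ≫ r = P.ε.app Y := coprod.inr_desc _ _
    have h' := (U.map_comp _ _).symm.trans (congrArg U.map h)
    exact (Category.assoc _ _ _).trans
      ((congrArg (adj.unit.app (U.obj Y) ≫ ·) h').trans (adj.right_triangle_components Y))
  have hu : ∀ χ, g ≫ u χ = U.map χ := by
    intro χ
    ext y
    have h : U.map r (g y) = y := ConcreteCategory.congr_hom hgr y
    exact (if_pos ⟨y, rfl⟩).trans (congrArg (U.map χ) h)
  have hu' : U.map s' ≫ u χ₁ = U.map s' ≫ u χ₂ := by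
    ext y
    have h : U.map s' y ∉ Set.range g := fun ⟨y₀, h⟩ => hs y y₀ h.symm
    exact (if_neg h).trans (if_neg h).symm
  rw [key χ₁ (u χ₁) (hu χ₁), key χ₂ (u χ₂) (hu χ₂), hu', hχ]

theorem AWFS.LMap.mono_of_ofComonad [MonoCoprod C] {P : Comonad C} {X Y : C} {f : X ⟶ Y}
    (s : (AWFS.ofComonad P).LMap f) : Mono f := by
  have h : f ≫ s.s = (coprod.inl : X ⟶ X ⨿ P.obj Y) := s.comp_s
  have : Mono (f ≫ s.s) := by
    rw [h]
    exact inferInstanceAs (Mono (coprod.inl : X ⟶ X ⨿ P.obj Y))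
  exact mono_of_mono f s.s

/-- If the counit of `P` at `Y` has a section, which need not be a coalgebra structure, then the map
from the initial object to `Y` belongs to the underlying left class. -/
theorem AWFS.leftClass_ofComonad_of_isInitial {P : Comonad C} {X Y : C} (hX : IsInitial X)
    (f : X ⟶ Y) (h : Y ⟶ P.obj Y) (hh : h ≫ P.ε.app Y = 𝟙 Y) : (AWFS.ofComonad P).leftClass f := by
  refine ⟨h ≫ (coprod.inr : P.obj Y ⟶ X ⨿ P.obj Y), hX.hom_ext _ _, ?_⟩
  have e : (coprod.inr : P.obj Y ⟶ X ⨿ P.obj Y) ≫ coprod.desc f (P.ε.app Y) = P.ε.app Y :=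
    coprod.inr_desc _ _
  exact (Category.assoc _ _ _).trans ((congrArg (h ≫ ·) e).trans hh)

end Free

/-! ### The example on sets with an action of `{1, e}` -/

/-- The factorization `f = 𝟙 ≫ f`. -/
def trivialFactorization (C : Type u) [Category.{v} C] : FunctorialFactorization C where
  E := Arrow.leftFunc
  lam f := 𝟙 f.left
  rho f := f.hom
  fac f := Category.id_comp f.hom
  lam_naturality _ := (Category.id_comp _).trans (Category.comp_id _).symm
  rho_naturality φ := φ.w

/-- The algebraic weak factorization system whose `𝕃`-maps are the isomorphisms. -/
def AWFS.trivial (C : Type u) [Category.{v} C] : AWFS C :=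
  AWFS.ofIdempotent (trivialFactorization C) (fun _ => rfl) (fun _ => rfl)
    (fun f => 𝟙 f.left) (fun f => 𝟙 f.left) (fun _ => Category.id_comp _)
    (fun _ => Category.id_comp _) (fun _ => Category.id_comp _) (fun _ => Category.id_comp _)

section MSet

variable (M : Type) [Monoid M]

/-- The functor sending an `M`-set to its set of fixed points. -/
def fixedPoints : Action (Type u) M ⥤ Type u where
  obj Y := { y : Y.V // ∀ m : M, Y.ρ m y = y }
  map {Y Z} f := TypeCat.ofHom fun y => ⟨f.hom y.1, fun m => by
    have h : Z.ρ m (f.hom y.1) = f.hom (Y.ρ m y.1) :=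
      (ConcreteCategory.congr_hom (f.comm m) y.1).symm
    rw [h, y.2 m]⟩

/-- The trivial action functor is left adjoint to the functor of fixed points. -/
def trivialMSetAdj : trivialMSet.{u} M ⊣ fixedPoints.{u} M :=
  Adjunction.mkOfUnitCounit
    { unit := { app := fun X => TypeCat.ofHom fun x => ⟨x, fun _ => rfl⟩ }
      counit :=
        { app := fun Y =>
            { hom := TypeCat.ofHom fun y => y.1
              comm := fun m => by
                ext y
                exact (y.2 m).symm } } }

instance : (trivialMSet.{u} M).IsLeftAdjoint := (trivialMSetAdj M).isLeftAdjoint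

instance : (trivialMSet.{u} M).Faithful where
  map_injective h := congrArg Action.Hom.hom h

instance : (Action.forget (Type u) M).IsRightAdjoint := (freeMSetAdj M).isRightAdjoint

instance : MonoCoprod (Action (Type u) M) :=
  MonoCoprod.monoCoprod_of_preservesCoprod_of_reflectsMono (Action.forget (Type u) M)

end MSet

open IdemMonoid

/-- No free generators can be attached to a set with trivial action so as to get a set with trivial
action. -/
theorem isIso_of_lMap_trivialMSet {X Y : Type u} (f : X ⟶ Y)
    (s : (AWFS.ofComonad (mSetComonad.{u} IdemMonoid)).LMap ((trivialMSet IdemMonoid).map f)) :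
    IsIso f := by
  let P := mSetComonad.{u} IdemMonoid
  let V := trivialMSet.{u} IdemMonoid
  let i : P.obj (V.obj Y) ⟶ V.obj X ⨿ P.obj (V.obj Y) := coprod.inr
  have hi : Function.Injective i.hom := by
    have : Mono ((Action.forget (Type u) IdemMonoid).map i) := inferInstance
    exact (mono_iff_injective _).1 this
  let gen : IdemMonoid → Y → (P.obj (V.obj Y)).V := fun m y => ((m, y) : IdemMonoid × Y)
  -- the values of `s` are fixed by `e`, unlike the free generators
  have h₁ : Epi (V.map f) := by
    refine s.epi_of_ne_generator (freeMSetAdj IdemMonoid)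
      fun y y₀ (h : s.s.hom y = i.hom (gen one y₀)) => ?_
    have hs : s.s.hom y = (V.obj X ⨿ P.obj (V.obj Y)).ρ e (s.s.hom y) :=
      ConcreteCategory.congr_hom (s.s.comm e) y
    have hg : i.hom (gen e y₀) = (V.obj X ⨿ P.obj (V.obj Y)).ρ e (i.hom (gen one y₀)) :=
      ConcreteCategory.congr_hom (i.comm e) (gen one y₀)
    rw [h, ← hg] at hs
    cases (congrArg Prod.fst (hi hs) : one = e)
  have h₂ : Mono (V.map f) := s.mono_of_ofComonad
  have := V.epi_of_epi_map h₁
  have := V.mono_of_mono_map h₂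
  exact isIso_of_mono_of_epi f

theorem isLeftLifting_trivialMSet :
    (AWFS.ofComonad (mSetComonad.{u} IdemMonoid)).IsLeftLifting (trivialMSet.{u} IdemMonoid)
      (AWFS.trivial (Type u)) := by
  refine AWFS.isLeftLifting_of_idempotent (fun _ => rfl) (fun {X Y} f => ?_) (fun {X Y} f s => ?_)
  · constructor
    · intro (h : IsIso f)
      infer_instance
    · intro h
      have h₁ : Epi f := (trivialMSet IdemMonoid).epi_of_epi_map inferInstance
      have h₂ : Mono f := (trivialMSet IdemMonoid).mono_of_mono_map inferInstance
      exact isIso_of_mono_of_epi f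
  · have := isIso_of_lMap_trivialMSet f s
    infer_instance

theorem inverseImage_existsL_trivialMSet :
    (AWFS.ofComonad (mSetComonad.{u} IdemMonoid)).existsL.inverseImage
      (trivialMSet.{u} IdemMonoid) = MorphismProperty.isomorphisms (Type u) := by
  ext X Y f
  refine ⟨fun ⟨s⟩ => isIso_of_lMap_trivialMSet f s, fun (h : IsIso f) => ?_⟩
  exact ⟨AWFS.LMap.ofIsIso _⟩

theorem retracts_inverseImage_existsL_trivialMSet :
    ((AWFS.ofComonad (mSetComonad.{u} IdemMonoid)).existsL.inverseImage
      (trivialMSet.{u} IdemMonoid)).retracts = MorphismProperty.isomorphisms (Type u) := by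
  rw [inverseImage_existsL_trivialMSet]
  exact le_antisymm (MorphismProperty.retracts_le _) (MorphismProperty.le_retracts _)

theorem retracts_iff_isEmpty (X : Type u) :
    ((AWFS.ofComonad (mSetComonad.{u} IdemMonoid)).existsL.inverseImage
      (trivialMSet.{u} IdemMonoid)).retracts (initial.to X) ↔ IsEmpty X := by
  rw [retracts_inverseImage_existsL_trivialMSet]
  have h : IsEmpty (⊥_ (Type u)) :=
    ⟨fun x => PEmpty.elim (initial.to PEmpty.{u + 1} x)⟩
  constructor
  · intro (h' : IsIso (initial.to X))
    exact ⟨fun x => h.elim (inv (initial.to X) x)⟩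
  · intro h'
    refine (isIso_iff_bijective (initial.to X)).2 ⟨fun x => h.elim x, fun x => h'.elim x⟩

theorem inverseImage_retracts_initial_to (X : Type u) :
    (AWFS.ofComonad (mSetComonad.{u} IdemMonoid)).existsL.retracts.inverseImage
      (trivialMSet.{u} IdemMonoid) (initial.to X) := by
  rw [← AWFS.leftClass_eq_retracts]
  -- `x ↦ (e, x)` is equivariant because `m * e = e` for all `m`, and it is a section of the counit
  let h : (trivialMSet.{u} IdemMonoid).obj X ⟶
      (mSetComonad.{u} IdemMonoid).obj ((trivialMSet.{u} IdemMonoid).obj X) :=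
    { hom := TypeCat.ofHom fun x : X => (e, x)
      comm := fun m => by
        ext x
        cases m <;> rfl }
  refine AWFS.leftClass_ofComonad_of_isInitial
    (IsInitial.isInitialObj (trivialMSet.{u} IdemMonoid) _ initialIsInitial) _ h ?_
  rfl

/-! ### The example on modules over `ℤ/6` -/

section Module

open TensorProduct

/-- The injection `ℤ/2 ⟶ ℤ/6`, given by multiplication by `3`. -/
noncomputable def threeMul : zmodTwo →ₗ[ZMod 6] ZMod 6 :=
  AddMonoidHom.toZModLinearMap 6
    (ZMod.lift 2 ⟨zmultiplesHom (ZMod 6) 3, by decide⟩ : ZMod 2 →+ ZMod 6)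

theorem threeMul_one : threeMul (show zmodTwo from (1 : ZMod 2)) = 3 := by
  refine (ZMod.lift_coe 2 ⟨zmultiplesHom (ZMod 6) 3, by decide⟩ 1).trans ?_
  exact one_smul ℤ (3 : ZMod 6)

theorem threeMul_smul_one (a : zmodTwo) : threeMul a • (show zmodTwo from (1 : ZMod 2)) = a := by
  revert a
  change ∀ a : ZMod 2, _
  intro a
  fin_cases a
  · refine (congrArg (· • (show zmodTwo from (1 : ZMod 2))) (map_zero threeMul)).trans ?_
    exact zero_smul _ _
  · refine (congrArg (· • (show zmodTwo from (1 : ZMod 2))) threeMul_one).trans ?_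
    change ZMod.castHom (show 2 ∣ 6 by norm_num) (ZMod 2) 3 * 1 = 1
    decide

/-- The quotient map `X ⟶ ℤ/2 ⊗ X`, sending `x` to `1 ⊗ x`. -/
noncomputable def toTensor (X : ModuleCat.{0} (ZMod 6)) : X ⟶ tensorZModTwo.obj X :=
  ModuleCat.ofHom (TensorProduct.mk (ZMod 6) zmodTwo X (show zmodTwo from (1 : ZMod 2)))

/-- The inclusion `ℤ/2 ⊗ X ⟶ X`, which identifies `ℤ/2 ⊗ X` with the submodule `3 X`. -/
noncomputable def ofTensor (X : ModuleCat.{0} (ZMod 6)) : tensorZModTwo.obj X ⟶ X :=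
  ModuleCat.ofHom (TensorProduct.lift ((LinearMap.lsmul (ZMod 6) X).comp threeMul))

variable {X Y : ModuleCat.{0} (ZMod 6)}

theorem ofTensor_toTensor (x : X) : ofTensor X (toTensor X x) = (3 : ZMod 6) • x := by
  refine (TensorProduct.lift.tmul _ _).trans ?_
  rw [← threeMul_one]
  rfl

theorem ofTensor_comp_toTensor : ofTensor X ≫ toTensor X = 𝟙 _ := by
  apply ModuleCat.hom_ext
  refine TensorProduct.ext' fun a x => ?_
  have h : (show zmodTwo from (1 : ZMod 2)) ⊗ₜ[ZMod 6] (threeMul a • x) = a ⊗ₜ[ZMod 6] x := by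
    rw [← TensorProduct.smul_tmul, threeMul_smul_one]
  exact h

theorem toTensor_ofTensor (v : tensorZModTwo.obj X) : toTensor X (ofTensor X v) = v :=
  ConcreteCategory.congr_hom ofTensor_comp_toTensor v

theorem map_toTensor (f : X ⟶ Y) (x : X) :
    tensorZModTwo.map f (toTensor X x) = toTensor Y (f x) := rfl

theorem ofTensor_map (f : X ⟶ Y) (v : tensorZModTwo.obj X) :
    ofTensor Y (tensorZModTwo.map f v) = f (ofTensor X v) := by
  obtain ⟨x, rfl⟩ : ∃ x, toTensor X x = v := ⟨_, toTensor_ofTensor v⟩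
  rw [map_toTensor, ofTensor_toTensor, ofTensor_toTensor, map_smul]

theorem two_smul_tensor (v : tensorZModTwo.obj X) : (2 : ZMod 6) • v = 0 := by
  rw [← toTensor_ofTensor ((2 : ZMod 6) • v), map_smul]
  rw [← toTensor_ofTensor v, ofTensor_toTensor, smul_smul]
  have h : (2 * 3 : ZMod 6) = 0 := by decide
  rw [h, zero_smul, map_zero]

/-- The middle object of the factorization of `f : X ⟶ Y` over `ℤ/6`: the product of the `2`-primary
part of `X`, annihilated by `4`, and the `3`-primary part of `Y`, annihilated by `3`. -/
def primaryMid (X Y : ModuleCat.{0} (ZMod 6)) : Submodule (ZMod 6) (X × Y) where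
  carrier := { z | (4 : ZMod 6) • z.1 = 0 ∧ (3 : ZMod 6) • z.2 = 0 }
  add_mem' := by
    rintro a b ⟨h₁, h₂⟩ ⟨h₃, h₄⟩
    exact ⟨by rw [Prod.fst_add, smul_add, h₁, h₃, add_zero],
      by rw [Prod.snd_add, smul_add, h₂, h₄, add_zero]⟩
  zero_mem' := ⟨smul_zero _, smul_zero _⟩
  smul_mem' := by
    rintro c a ⟨h₁, h₂⟩
    exact ⟨by rw [Prod.smul_fst, smul_comm, h₁, smul_zero],
      by rw [Prod.smul_snd, smul_comm, h₂, smul_zero]⟩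

theorem three_smul_of_four_smul {N : Type*} [AddCommGroup N] [Module (ZMod 6) N] {x : N}
    (h : (4 : ZMod 6) • x = 0) : (3 : ZMod 6) • x = x := by
  have e : (3 + 4 : ZMod 6) = 1 := by decide
  rw [← add_zero ((3 : ZMod 6) • x), ← h, ← add_smul, e, one_smul]

theorem four_smul_of_three_smul {N : Type*} [AddCommGroup N] [Module (ZMod 6) N] {x : N}
    (h : (3 : ZMod 6) • x = 0) : (4 : ZMod 6) • x = x := by
  have e : (3 + 4 : ZMod 6) = 1 := by decide
  rw [← zero_add ((4 : ZMod 6) • x), ← h, ← add_smul, e, one_smul]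

theorem four_smul_three_smul {N : Type*} [AddCommGroup N] [Module (ZMod 6) N] (x : N) :
    (4 : ZMod 6) • (3 : ZMod 6) • x = 0 := by
  have e : (4 * 3 : ZMod 6) = 0 := by decide
  rw [smul_smul, e, zero_smul]

theorem three_smul_four_smul {N : Type*} [AddCommGroup N] [Module (ZMod 6) N] (x : N) :
    (3 : ZMod 6) • (4 : ZMod 6) • x = 0 := by
  rw [smul_comm, four_smul_three_smul]

theorem eq_zero_of_primary {N : Type*} [AddCommGroup N] [Module (ZMod 6) N] {x : N}
    (h : (3 : ZMod 6) • x = 0) (h' : (4 : ZMod 6) • x = 0) : x = 0 :=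
  (three_smul_of_four_smul h').symm.trans h

/-- The factorization of a map of `ℤ/6`-modules into a map which is invertible on `2`-primary parts
and a map which is invertible on `3`-primary parts. -/
noncomputable def primaryFactorization : FunctorialFactorization (ModuleCat.{0} (ZMod 6)) where
  E :=
    { obj := fun f => ModuleCat.of (ZMod 6) (primaryMid f.left f.right)
      map := fun φ => ModuleCat.ofHom
        ((LinearMap.prodMap φ.left.hom φ.right.hom).restrict fun z hz =>
          ⟨by
            change (4 : ZMod 6) • φ.left.hom z.1 = 0
            rw [← map_smul, hz.1, map_zero],
          by
            change (3 : ZMod 6) • φ.right.hom z.2 = 0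
            rw [← map_smul, hz.2, map_zero]⟩)
      map_id := fun f => rfl
      map_comp := fun φ ψ => rfl }
  lam f := ModuleCat.ofHom
    ((LinearMap.prod ((3 : ZMod 6) • LinearMap.id) ((4 : ZMod 6) • f.hom.hom)).codRestrict _
      fun x => ⟨by exact four_smul_three_smul (N := f.left) x,
        by exact three_smul_four_smul (N := f.right) (f.hom.hom x)⟩)
  rho f := ModuleCat.ofHom
    ((LinearMap.coprod f.hom.hom LinearMap.id).comp (primaryMid f.left f.right).subtype)
  fac f := by
    apply ModuleCat.hom_ext
    ext x
    change f.hom.hom ((3 : ZMod 6) • x) + (4 : ZMod 6) • f.hom.hom x = f.hom.hom x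
    have e : (3 + 4 : ZMod 6) = 1 := by decide
    rw [map_smul, ← add_smul, e, one_smul]
  lam_naturality {f g} φ := by
    apply ModuleCat.hom_ext
    refine LinearMap.ext fun x => ?_
    refine Subtype.ext (Prod.ext ?_ ?_)
    · exact map_smul φ.left.hom (3 : ZMod 6) x
    · refine (map_smul φ.right.hom (4 : ZMod 6) (f.hom.hom x)).trans ?_
      exact congrArg ((4 : ZMod 6) • ·) (ConcreteCategory.congr_hom φ.w x).symm
  rho_naturality {f g} φ := by
    apply ModuleCat.hom_ext
    ext z
    refine Eq.trans ?_ (map_add φ.right.hom (f.hom.hom z.1.1) z.1.2).symm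
    exact congrArg (· + φ.right.hom z.1.2) (ConcreteCategory.congr_hom φ.w z.1.1)

theorem primaryFactorization_E_eps (f : Arrow (ModuleCat.{0} (ZMod 6))) :
    primaryFactorization.E.map (primaryFactorization.eps.app f) =
      primaryFactorization.rho (primaryFactorization.L.obj f) := by
  apply ModuleCat.hom_ext
  refine LinearMap.ext fun
    (z : primaryMid f.left (ModuleCat.of _ (primaryMid f.left f.right))) => ?_
  obtain ⟨⟨x, ⟨⟨x', y⟩, hx', hy⟩⟩, hx, hz⟩ := z
  have e₁ : (3 : ZMod 6) • x' = 0 := congrArg (fun t => t.1.1) hz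
  obtain rfl : x' = 0 := eq_zero_of_primary e₁ hx'
  refine Subtype.ext (Prod.ext ?_ ?_)
  · change x = (3 : ZMod 6) • x + 0
    rw [add_zero, three_smul_of_four_smul hx]
  · change f.hom.hom 0 + y = (4 : ZMod 6) • f.hom.hom x + y
    have hx : (4 : ZMod 6) • x = 0 := hx
    rw [← map_smul, hx]

theorem primaryFactorization_E_eta (f : Arrow (ModuleCat.{0} (ZMod 6))) :
    primaryFactorization.E.map (primaryFactorization.eta.app f) =
      primaryFactorization.lam (primaryFactorization.R.obj f) := by
  apply ModuleCat.hom_ext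
  refine LinearMap.ext fun (z : primaryMid f.left f.right) => ?_
  obtain ⟨⟨x, y⟩, hx, hy⟩ := z
  have hx : (4 : ZMod 6) • x = 0 := hx
  have hy : (3 : ZMod 6) • y = 0 := hy
  have h : (4 : ZMod 6) • f.hom.hom x = 0 := by rw [← map_smul, hx, map_zero]
  refine Subtype.ext (Prod.ext (Subtype.ext (Prod.ext rfl ?_)) ?_)
  · exact h.trans hy.symm
  · change y = (4 : ZMod 6) • (f.hom.hom x + y)
    rw [smul_add, h, zero_add, four_smul_of_three_smul hy]

/-- The comultiplication filler `(x, y) ↦ (x, (0, y))`. -/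
noncomputable def primaryDel (f : Arrow (ModuleCat.{0} (ZMod 6))) :
    primaryFactorization.E.obj f ⟶
      primaryFactorization.E.obj (primaryFactorization.L.obj f) :=
  ModuleCat.ofHom (X := primaryMid f.left f.right)
    (Y := primaryMid f.left (ModuleCat.of _ (primaryMid f.left f.right)))
    ((LinearMap.prod ((LinearMap.fst (ZMod 6) f.left f.right).comp (Submodule.subtype _))
      ((4 : ZMod 6) • LinearMap.id)).codRestrict _ fun z => ⟨z.2.1, by
        exact three_smul_four_smul (N := primaryMid f.left f.right) z⟩)

/-- The multiplication filler `((x, 0), y) ↦ (x, y)`. -/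
noncomputable def primaryMu (f : Arrow (ModuleCat.{0} (ZMod 6))) :
    primaryFactorization.E.obj (primaryFactorization.R.obj f) ⟶
      primaryFactorization.E.obj f :=
  ModuleCat.ofHom (X := primaryMid (ModuleCat.of _ (primaryMid f.left f.right)) f.right)
    (Y := primaryMid f.left f.right)
    ((LinearMap.prodMap ((LinearMap.fst (ZMod 6) f.left f.right).comp (Submodule.subtype _))
      LinearMap.id).restrict fun z hz => ⟨z.1.2.1, hz.2⟩)

theorem primaryDel_rho (f : Arrow (ModuleCat.{0} (ZMod 6))) :
    primaryDel f ≫ primaryFactorization.rho (primaryFactorization.L.obj f) = 𝟙 _ := by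
  rw [← primaryFactorization_E_eps]
  apply ModuleCat.hom_ext
  refine LinearMap.ext fun (z : primaryMid f.left f.right) => ?_
  obtain ⟨⟨x, y⟩, hx, hy⟩ := z
  have hx : (4 : ZMod 6) • x = 0 := hx
  refine Subtype.ext (Prod.ext rfl ?_)
  change f.hom.hom ((4 : ZMod 6) • x) + (4 : ZMod 6) • y = y
  rw [hx, map_zero, zero_add, four_smul_of_three_smul hy]

theorem rho_primaryDel (f : Arrow (ModuleCat.{0} (ZMod 6))) :
    primaryFactorization.rho (primaryFactorization.L.obj f) ≫ primaryDel f = 𝟙 _ := by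
  rw [← primaryFactorization_E_eps]
  apply ModuleCat.hom_ext
  refine LinearMap.ext fun
    (z : primaryMid f.left (ModuleCat.of _ (primaryMid f.left f.right))) => ?_
  obtain ⟨⟨x, ⟨⟨x', y⟩, hx', hy⟩⟩, hx, hz⟩ := z
  have e₁ : (3 : ZMod 6) • x' = 0 := congrArg (fun t => t.1.1) hz
  have hx : (4 : ZMod 6) • x = 0 := hx
  obtain rfl : x' = 0 := eq_zero_of_primary e₁ hx'
  refine Subtype.ext (Prod.ext rfl (Subtype.ext (Prod.ext hx ?_)))
  change (4 : ZMod 6) • (f.hom.hom 0 + y) = y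
  rw [map_zero, zero_add, four_smul_of_three_smul hy]

theorem lam_primaryMu (f : Arrow (ModuleCat.{0} (ZMod 6))) :
    primaryFactorization.lam (primaryFactorization.R.obj f) ≫ primaryMu f = 𝟙 _ := by
  rw [← primaryFactorization_E_eta]
  apply ModuleCat.hom_ext
  refine LinearMap.ext fun (z : primaryMid f.left f.right) => ?_
  exact Subtype.ext (Prod.ext (three_smul_of_four_smul z.2.1) rfl)

theorem primaryMu_lam (f : Arrow (ModuleCat.{0} (ZMod 6))) :
    primaryMu f ≫ primaryFactorization.lam (primaryFactorization.R.obj f) = 𝟙 _ := by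
  rw [← primaryFactorization_E_eta]
  apply ModuleCat.hom_ext
  refine LinearMap.ext fun
    (z : primaryMid (ModuleCat.of _ (primaryMid f.left f.right)) f.right) => ?_
  obtain ⟨⟨⟨⟨x, y'⟩, hx, hy'⟩, y⟩, hz, hy⟩ := z
  have e₁ : (4 : ZMod 6) • y' = 0 := congrArg (fun t => t.1.2) hz
  have hx : (4 : ZMod 6) • x = 0 := hx
  obtain rfl : y' = 0 := eq_zero_of_primary hy' e₁
  refine Subtype.ext (Prod.ext (Subtype.ext (Prod.ext (three_smul_of_four_smul hx) ?_)) rfl)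
  change (4 : ZMod 6) • f.hom.hom x = 0
  rw [← map_smul, hx, map_zero]

/-- The algebraic weak factorization system on `ℤ/6`-modules whose `𝕃`-maps are the maps that are
invertible on `2`-primary parts. -/
noncomputable def primaryAWFS : AWFS (ModuleCat.{0} (ZMod 6)) :=
  AWFS.ofIdempotent primaryFactorization primaryFactorization_E_eps primaryFactorization_E_eta
    primaryDel primaryMu primaryDel_rho rho_primaryDel lam_primaryMu primaryMu_lam

/-- Both conditions say that `f` restricts to an isomorphism `3 X ⟶ 3 Y`. -/
theorem isIso_rho_primaryAWFS_iff (f : X ⟶ Y) :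
    IsIso (primaryAWFS.rho (Arrow.mk f)) ↔ IsIso (tensorZModTwo.map f) := by
  rw [ConcreteCategory.isIso_iff_bijective, ConcreteCategory.isIso_iff_bijective]
  have hρ : ∀ z : primaryMid X Y, primaryAWFS.rho (Arrow.mk f) z = f z.1.1 + z.1.2 := fun _ => rfl
  have h₃ : ∀ {N : ModuleCat.{0} (ZMod 6)} (v : tensorZModTwo.obj N),
      (3 : ZMod 6) • ofTensor N v = ofTensor N v := fun v => by
    rw [← ofTensor_toTensor, toTensor_ofTensor]
  have h₄ : ∀ {N : ModuleCat.{0} (ZMod 6)} (v : tensorZModTwo.obj N),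
      (4 : ZMod 6) • ofTensor N v = 0 := fun v => by
    rw [← h₃, four_smul_three_smul]
  have h₀ : ∀ {N : ModuleCat.{0} (ZMod 6)} {x : N}, (3 : ZMod 6) • x = 0 → toTensor N x = 0 :=
    fun {N x} hx => by
      rw [← toTensor_ofTensor (toTensor N x), ofTensor_toTensor, hx, map_zero]
  constructor
  · rintro ⟨hi, hs⟩
    constructor
    · rw [injective_iff_map_eq_zero]
      intro v hv
      have hfv : f (ofTensor X v) = 0 := by rw [← ofTensor_map, hv, map_zero]
      let z : primaryMid X Y := ⟨(ofTensor X v, 0), h₄ v, smul_zero _⟩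
      have hz : z = 0 := hi
        (((hρ z).trans ((add_zero _).trans hfv)).trans (map_zero _).symm)
      have hv' : ofTensor X v = 0 := congrArg (fun t => t.1.1) hz
      rw [← toTensor_ofTensor v, hv', map_zero]
    · intro w
      obtain ⟨⟨⟨x, y⟩, hx, hy⟩, hz⟩ := hs (ofTensor Y w)
      have hz : f x + (show Y from y) = ofTensor Y w := hz
      refine ⟨toTensor X x, ?_⟩
      rw [map_toTensor, ← toTensor_ofTensor w, ← hz, map_add,
        h₀ (show (3 : ZMod 6) • (show Y from y) = 0 from hy), add_zero]
  · rintro ⟨hi, hs⟩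
    constructor
    · rw [injective_iff_map_eq_zero]
      intro (z : primaryMid X Y) hz
      obtain ⟨⟨x, y⟩, hx, hy⟩ := z
      have hx : (4 : ZMod 6) • x = 0 := hx
      have hy : (3 : ZMod 6) • y = 0 := hy
      have hz : f x + y = 0 := hz
      have hfx : toTensor Y (f x) = 0 := by
        rw [← add_zero (toTensor Y (f x)), ← congrArg (toTensor Y (f x) + ·) (h₀ hy), ← map_add, hz,
          map_zero]
      have hx' : toTensor X x = 0 := hi (by rw [map_toTensor, hfx, map_zero])
      obtain rfl : x = 0 := by
        rw [← three_smul_of_four_smul hx, ← ofTensor_toTensor, hx', map_zero]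
      obtain rfl : y = 0 := by rwa [map_zero, zero_add] at hz
      rfl
    · intro (y : Y)
      obtain ⟨v, hv⟩ := hs (toTensor Y y)
      refine ⟨(⟨(ofTensor X v, (4 : ZMod 6) • y), h₄ v, three_smul_four_smul y⟩ :
        primaryMid X Y), ?_⟩
      change f (ofTensor X v) + (4 : ZMod 6) • y = y
      have e : (3 + 4 : ZMod 6) = 1 := by decide
      rw [← ofTensor_map, hv, ofTensor_toTensor, ← add_smul, e, one_smul]

/-- No free generators can be attached to a module annihilated by `2` so as to get a module
annihilated by `2`. -/
theorem isIso_of_lMap_tensorZModTwo (f : X ⟶ Y)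
    (s : (AWFS.ofComonad moduleComonad).LMap (tensorZModTwo.map f)) :
    IsIso (tensorZModTwo.map f) := by
  let P := moduleComonad
  let V := tensorZModTwo
  let i : P.obj (V.obj Y) ⟶ V.obj X ⨿ P.obj (V.obj Y) := coprod.inr
  have hi : Function.Injective i := (ModuleCat.mono_iff_injective i).1 inferInstance
  let s' : V.obj Y ⟶ V.obj X ⨿ P.obj (V.obj Y) := s.s
  let gen : V.obj Y → P.obj (V.obj Y) := fun y => Finsupp.single y (1 : ZMod 6)
  -- the values of `s` are annihilated by `2`, unlike the free generators
  have h₁ : Epi (V.map f) := by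
    refine s.epi_of_ne_generator (ModuleCat.adj (ZMod 6))
      fun (y y₀ : V.obj Y) (h : s' y = i (gen y₀)) => ?_
    have h₂ : i ((2 : ZMod 6) • gen y₀) = 0 := by
      rw [map_smul, ← h, ← map_smul, two_smul_tensor, map_zero]
    have h₃ : (2 : ZMod 6) • gen y₀ = 0 := hi (h₂.trans (map_zero _).symm)
    have h₄ : (2 : ZMod 6) * 1 = 0 := by
      have h₅ : Finsupp.single y₀ (1 : ZMod 6) y₀ = 1 := Finsupp.single_eq_same
      refine (congrArg (fun t => (2 : ZMod 6) * t) h₅.symm).trans ?_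
      exact congrArg (fun t : V.obj Y →₀ ZMod 6 => t y₀) h₃
    exact absurd h₄ (by decide)
  have h₂ : Mono (V.map f) := s.mono_of_ofComonad
  exact isIso_of_mono_of_epi _

instance : tensorZModTwo.IsLeftAdjoint := (ihom.adjunction zmodTwo).isLeftAdjoint

theorem isLeftLifting_tensorZModTwo :
    (AWFS.ofComonad moduleComonad).IsLeftLifting tensorZModTwo primaryAWFS :=
  AWFS.isLeftLifting_of_idempotent primaryFactorization_E_eps isIso_rho_primaryAWFS_iff
    isIso_of_lMap_tensorZModTwo

theorem retracts_inverseImage_existsL_tensorZModTwo :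
    ((AWFS.ofComonad moduleComonad).existsL.inverseImage tensorZModTwo).retracts =
      (MorphismProperty.isomorphisms _).inverseImage tensorZModTwo := by
  have h : (AWFS.ofComonad moduleComonad).existsL.inverseImage tensorZModTwo =
      (MorphismProperty.isomorphisms _).inverseImage tensorZModTwo := by
    ext X Y f
    exact ⟨fun ⟨s⟩ => isIso_of_lMap_tensorZModTwo f s,
      fun (_ : IsIso (tensorZModTwo.map f)) => ⟨AWFS.LMap.ofIsIso _⟩⟩
  rw [h]
  exact le_antisymm (MorphismProperty.retracts_le _) (MorphismProperty.le_retracts _)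

theorem not_retracts_initial_to_zmodSix :
    ¬ ((AWFS.ofComonad moduleComonad).existsL.inverseImage tensorZModTwo).retracts
      (initial.to (ModuleCat.of (ZMod 6) (ZMod 6))) := by
  rw [retracts_inverseImage_existsL_tensorZModTwo]
  intro (h : IsIso (tensorZModTwo.map (initial.to (ModuleCat.of (ZMod 6) (ZMod 6)))))
  let I : ModuleCat.{0} (ZMod 6) := ⊥_ _
  let f : I ⟶ ModuleCat.of (ZMod 6) (ZMod 6) := initial.to _
  have hI : Subsingleton I :=
    ModuleCat.subsingleton_of_isZero (HasZeroObject.zeroIsoInitial.isZero_iff.1 (isZero_zero _))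
  obtain ⟨v, hv⟩ := ((ConcreteCategory.isIso_iff_bijective (tensorZModTwo.map f)).1 h).2
    (toTensor _ (1 : ZMod 6))
  have h₁ : f (ofTensor I v) = (3 : ZMod 6) • (1 : ZMod 6) := by
    rw [← ofTensor_map, hv, ofTensor_toTensor]
  rw [Subsingleton.elim (ofTensor I v) 0, map_zero] at h₁
  exact absurd h₁ (by decide)

/-- The free module of rank one is projective with respect to the counit of the free-forgetful
comonad. -/
theorem exists_comp_counit_eq (N : ModuleCat.{0} (ZMod 6)) (y : N) :
    ∃ g : ModuleCat.of (ZMod 6) (ZMod 6) ⟶ moduleComonad.obj N,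
      g ≫ moduleComonad.ε.app N = ModuleCat.ofHom (LinearMap.toSpanSingleton (ZMod 6) N y) := by
  let t : moduleComonad.obj N := (ModuleCat.adj (ZMod 6)).unit.app _ y
  have ht : moduleComonad.ε.app N t = y :=
    ConcreteCategory.congr_hom ((ModuleCat.adj (ZMod 6)).right_triangle_components N) y
  refine ⟨ModuleCat.ofHom (LinearMap.toSpanSingleton (ZMod 6) _ t), ?_⟩
  apply ModuleCat.hom_ext
  refine LinearMap.ext fun r => ?_
  exact (map_smul (moduleComonad.ε.app N).hom r t).trans (congrArg (r • ·) ht)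

/-- `ℤ/2 ⊗ ℤ/6` is a retract of `ℤ/6`, hence projective. -/
theorem inverseImage_retracts_initial_to_zmodSix :
    (AWFS.ofComonad moduleComonad).existsL.retracts.inverseImage tensorZModTwo
      (initial.to (ModuleCat.of (ZMod 6) (ZMod 6))) := by
  rw [← AWFS.leftClass_eq_retracts]
  obtain ⟨g, hg⟩ := exists_comp_counit_eq _
    (toTensor (ModuleCat.of (ZMod 6) (ZMod 6)) (1 : ZMod 6))
  have hg' : ModuleCat.ofHom (LinearMap.toSpanSingleton (ZMod 6) _
      (toTensor (ModuleCat.of (ZMod 6) (ZMod 6)) (1 : ZMod 6))) = toTensor _ := by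
    apply ModuleCat.hom_ext
    exact LinearMap.ext_ring (one_smul _ _)
  refine AWFS.leftClass_ofComonad_of_isInitial
    (IsInitial.isInitialObj tensorZModTwo _ initialIsInitial) _ (ofTensor _ ≫ g) ?_
  rw [Category.assoc, hg, hg', ofTensor_comp_toTensor]

end Module

end AWFSLifting

/-! ### The failure of both parts of the claim -/

theorem mainTheorem4 :
    -- for every left-lifting one inclusion always holds, and the underlying weak factorization
    -- system of the left-lifting is the left-lifting of the underlying weak factorization system
    -- if and only if `Retr(V⁻¹(∃𝕃)) = V⁻¹(Retr(∃𝕃))`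
    (∀ (M : Type u) [Category.{v} M] (K : Type u') [Category.{v'} K] (A : AWFS M) (V : K ⥤ M)
        (A' : AWFS K), V.IsLeftAdjoint → A.IsLeftLifting V A' →
      (A.existsL.inverseImage V).retracts ≤ A.existsL.retracts.inverseImage V ∧
      (A.UnderlyingIsLeftLifted V A' ↔
        (A.existsL.inverseImage V).retracts = A.existsL.retracts.inverseImage V)) ∧
    -- both parts of the claim are false
    ¬ LeftLiftingClaim.{w, w + 1, w, w + 1} ∧
    ¬ RightLiftingClaim.{w, w + 1, w, w + 1} ∧
    -- the counterexample on `ℤ/6`-modules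
    (tensorZModTwo.IsLeftAdjoint ∧
      (∃ A', (AWFS.ofComonad moduleComonad).IsLeftLifting tensorZModTwo A') ∧
      (∀ A', (AWFS.ofComonad moduleComonad).IsLeftLifting tensorZModTwo A' →
        ¬ (AWFS.ofComonad moduleComonad).UnderlyingIsLeftLifted tensorZModTwo A') ∧
      ((AWFS.ofComonad moduleComonad).existsL.inverseImage tensorZModTwo).retracts <
        (AWFS.ofComonad moduleComonad).existsL.retracts.inverseImage tensorZModTwo ∧
      (AWFS.ofComonad moduleComonad).existsL.retracts.inverseImage tensorZModTwo
        (initial.to (ModuleCat.of (ZMod 6) (ZMod 6))) ∧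
      ¬ ((AWFS.ofComonad moduleComonad).existsL.inverseImage tensorZModTwo).retracts
        (initial.to (ModuleCat.of (ZMod 6) (ZMod 6)))) ∧
    -- the counterexample on `M`-sets with `M = {1, e}`
    ((trivialMSet.{w} IdemMonoid).IsLeftAdjoint ∧
      (∃ A', (AWFS.ofComonad (mSetComonad.{w} IdemMonoid)).IsLeftLifting
        (trivialMSet.{w} IdemMonoid) A') ∧
      (∀ A', (AWFS.ofComonad (mSetComonad.{w} IdemMonoid)).IsLeftLifting
          (trivialMSet.{w} IdemMonoid) A' →
        ¬ (AWFS.ofComonad (mSetComonad.{w} IdemMonoid)).UnderlyingIsLeftLifted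
          (trivialMSet.{w} IdemMonoid) A') ∧
      ((AWFS.ofComonad (mSetComonad.{w} IdemMonoid)).existsL.inverseImage
          (trivialMSet.{w} IdemMonoid)).retracts <
        (AWFS.ofComonad (mSetComonad.{w} IdemMonoid)).existsL.retracts.inverseImage
          (trivialMSet.{w} IdemMonoid) ∧
      ∀ X : Type w,
        (AWFS.ofComonad (mSetComonad.{w} IdemMonoid)).existsL.retracts.inverseImage
          (trivialMSet.{w} IdemMonoid) (initial.to X) ∧
        (((AWFS.ofComonad (mSetComonad.{w} IdemMonoid)).existsL.inverseImage
          (trivialMSet.{w} IdemMonoid)).retracts (initial.to X) ↔ IsEmpty X)) := by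
  have hM : ((AWFS.ofComonad (mSetComonad.{w} IdemMonoid)).existsL.inverseImage
      (trivialMSet.{w} IdemMonoid)).retracts <
        (AWFS.ofComonad (mSetComonad.{w} IdemMonoid)).existsL.retracts.inverseImage
          (trivialMSet.{w} IdemMonoid) := by
    refine AWFS.retracts_inverseImage_existsL_le.lt_of_not_ge fun h => ?_
    exact ((retracts_iff_isEmpty PUnit).1
      (h _ (inverseImage_retracts_initial_to PUnit))).elim PUnit.unit
  have hZ : ((AWFS.ofComonad moduleComonad).existsL.inverseImage tensorZModTwo).retracts <
        (AWFS.ofComonad moduleComonad).existsL.retracts.inverseImage tensorZModTwo := by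
    refine AWFS.retracts_inverseImage_existsL_le.lt_of_not_ge fun h => ?_
    exact not_retracts_initial_to_zmodSix (h _ inverseImage_retracts_initial_to_zmodSix)
  have hM' : ∀ A', (AWFS.ofComonad (mSetComonad.{w} IdemMonoid)).IsLeftLifting
      (trivialMSet.{w} IdemMonoid) A' →
        ¬ (AWFS.ofComonad (mSetComonad.{w} IdemMonoid)).UnderlyingIsLeftLifted
          (trivialMSet.{w} IdemMonoid) A' :=
    fun A' h h' => hM.ne (h.underlyingIsLeftLifted_iff.1 h')
  refine ⟨fun M _ K _ A V A' _ h =>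
      ⟨AWFS.retracts_inverseImage_existsL_le, h.underlyingIsLeftLifted_iff⟩,
    fun H => hM' _ isLeftLifting_trivialMSet
      (H _ _ _ _ _ inferInstance isLeftLifting_trivialMSet),
    isLeftLifting_trivialMSet.not_rightLiftingClaim inferInstance
      (hM' _ isLeftLifting_trivialMSet),
    ⟨inferInstance, ⟨_, isLeftLifting_tensorZModTwo⟩,
      fun A' h h' => hZ.ne (h.underlyingIsLeftLifted_iff.1 h'), hZ,
      inverseImage_retracts_initial_to_zmodSix, not_retracts_initial_to_zmodSix⟩,
    inferInstance, ⟨_, isLeftLifting_trivialMSet⟩, hM', hM,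
    fun X => ⟨inverseImage_retracts_initial_to X, retracts_iff_isEmpty X⟩⟩
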